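/- Let $p$ be a prime and $\mathbb K=\mathbb Z/p^2\mathbb Z$. For a commutative ring $k$, a unital associative $k$-algebra $A$ and an $A$-bimodule $M$ (with $k$ acting on $M$ in the same way from the left and from the right), the Shukla cohomology $\mathrm{Shukla}^n(A/k,M)$, $n\ge 0$, is the $n$-th cohomology of the total complex of the Hochschild bicomplex $\mathrm{Hom}_k(R_*^{\otimes_k q},M)$, where $R_*\to A$ is a weak equivalence of chain $k$-algebras whose source $R_*$ (concentrated in degrees $\ge 0$) is quasi-free, i.e. free as a graded algebra; it does not depend on the choice of $R_*$. It is covariant in $M$, contravariant in $A$ and contravariant in $k$. Let $A$ be an $\mathbb F_p$-algebra and $M$ an $A$-bimodule, and let $$b^n=b^n_{A,M}:\ \mathrm{Shukla}^n(A/\mathbb K,M)\to \mathrm{Shukla}^n(A/\mathbb Z,M)$$ be the base change homomorphism induced by $\mathbb Z\to\mathbb K$. Then: 1. $b^n$ is surjective for all $n\ge 0$, and it is an isomorphism for $n\le 2$. 2. For every $n\ge 0$ the epimorphism $b^n$ has a natural splitting: there are group homomorphisms $d^n_{A,M}:\mathrm{Shukla}^n(A/\mathbb Z,M)\to\mathrm{Shukla}^n(A/\mathbb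 K,M)$, for all $\mathbb F_p$-algebras $A$ and all $A$-bimodules $M$, such that $b^n_{A,M}\circ d^n_{A,M}=\mathrm{id}$, and such that for every homomorphism $f:A\to A'$ of $\mathbb F_p$-algebras, every $A$-bimodule $M$, every $A'$-bimodule $M'$ and every homomorphism of $A$-bimodules $\varphi:f^*M'\to M$ the maps $d^n$ commute with the homomorphisms $\mathrm{Shukla}^n(A'/k,M')\to\mathrm{Shukla}^n(A/k,M)$, $k=\mathbb Z,\mathbb K$, induced by $f$ and $\varphi$. -/

import Mathlib

set_option linter.unusedSectionVars false

universe u v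

noncomputable section

namespace FreeGraded

variable {K : Type} [CommRing K] {G : Type u}

/-- The homogeneous component of degree `n` of the free algebra on a graded set: the span of the
words of total degree `n`. -/
def component (K : Type) [CommRing K] {G : Type u} (deg : G → ℕ) (n : ℕ) :
    Submodule K (FreeAlgebra K G) :=
  Submodule.span K {x | ∃ l : List G, (l.map deg).sum = n ∧ x = (l.map (FreeAlgebra.ι K)).prod}

variable (deg : G → ℕ)

lemma word_mem (l : List G) :
    (l.map (FreeAlgebra.ι K)).prod ∈ component K deg (l.map deg).sum :=
  Submodule.subset_span ⟨l, rfl, rfl⟩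

lemma ι_mem (g : G) : FreeAlgebra.ι K g ∈ component K deg (deg g) := by
  simpa using word_mem (K := K) deg [g]

instance : SetLike.GradedMonoid (component K deg) where
  one_mem := by simpa using word_mem (K := K) deg []
  mul_mem i j x y hx hy := by
    have h := Submodule.mul_mem_mul hx hy
    rw [component, component, Submodule.span_mul_span] at h
    refine Submodule.span_mono ?_ h
    rintro _ ⟨_, ⟨l, rfl, rfl⟩, _, ⟨l', rfl, rfl⟩, rfl⟩
    exact ⟨l ++ l', by simp, by simp⟩

instance gradedAlgebra : GradedAlgebra (component K deg) :=
  GradedAlgebra.ofAlgHom _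
    (FreeAlgebra.lift K fun g =>
      DirectSum.of (fun i => component K deg i) (deg g) ⟨FreeAlgebra.ι K g, ι_mem deg g⟩)
    (by ext g; simp)
    (by
      have key : ∀ l : List G, FreeAlgebra.lift K (fun g =>
          DirectSum.of (fun i => component K deg i) (deg g) ⟨FreeAlgebra.ι K g, ι_mem deg g⟩)
          (l.map (FreeAlgebra.ι K)).prod =
          DirectSum.of (fun i => component K deg i) (l.map deg).sum
            ⟨(l.map (FreeAlgebra.ι K)).prod, word_mem deg l⟩ := by
        intro l
        induction l with
        | nil => simp; rfl
        | cons g l ih =>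
          simp only [List.map_cons, List.prod_cons, map_mul, ih, FreeAlgebra.lift_ι_apply,
            DirectSum.of_mul_of]
          exact DirectSum.of_eq_of_gradedMonoid_eq (Sigma.subtype_ext rfl rfl)
      rintro i ⟨x, hx⟩
      induction hx using Submodule.span_induction with
      | mem x h => obtain ⟨l, rfl, rfl⟩ := h; exact key l
      | zero => rw [map_zero]; exact (map_zero _).symm
      | add x y hx hy ihx ihy =>
        rw [map_add]; erw [ihx, ihy]; rw [← map_add]; rfl
      | smul k x hx ih =>
        rw [map_smul]; erw [ih]; rw [← DirectSum.lof_eq_of K, ← map_smul]; rfl)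

/-- The algebra automorphism `x ↦ (-1) ^ |x| x` -/
def sign : FreeAlgebra K G →ₐ[K] FreeAlgebra K G :=
  FreeAlgebra.lift K fun g => (-1 : K) ^ deg g • FreeAlgebra.ι K g

lemma sign_of_mem {n : ℕ} {x : FreeAlgebra K G} (hx : x ∈ component K deg n) :
    sign deg x = (-1 : K) ^ n • x := by
  induction hx using Submodule.span_induction with
  | mem x h =>
    obtain ⟨l, rfl, rfl⟩ := h
    induction l with
    | nil => simp
    | cons g l ih =>
      simp only [List.map_cons, List.prod_cons, map_mul, ih, List.sum_cons]
      rw [sign, FreeAlgebra.lift_ι_apply, smul_mul_smul_comm, pow_add]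
  | zero => simp
  | add x y _ _ hx hy => rw [map_add, hx, hy, smul_add]
  | smul k x _ hx => rw [map_smul, hx, smul_comm]

variable (dgen : G → FreeAlgebra K G)

/-- The multiplicative map `x ↦ (σ x, d x; 0, x)` -/
def boundaryMatrix : FreeAlgebra K G →ₐ[K] Matrix (Fin 2) (Fin 2) (FreeAlgebra K G) :=
  FreeAlgebra.lift K fun g => !![sign deg (FreeAlgebra.ι K g), dgen g; 0, FreeAlgebra.ι K g]

/-- The graded derivation of degree `-1` with prescribed values on generators. -/
def boundary : FreeAlgebra K G →ₗ[K] FreeAlgebra K G :=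
  Matrix.entryLinearMap K (FreeAlgebra K G) 0 1 ∘ₗ (boundaryMatrix deg dgen).toLinearMap

lemma boundaryMatrix_eq (x : FreeAlgebra K G) :
    boundaryMatrix deg dgen x = !![sign deg x, boundary deg dgen x; 0, x] := by
  have h : boundaryMatrix deg dgen x 0 0 = sign deg x ∧ boundaryMatrix deg dgen x 1 0 = 0 ∧
      boundaryMatrix deg dgen x 1 1 = x := by
    induction x with
    | grade0 r => simp [Matrix.algebraMap_matrix_apply]
    | grade1 g => simp [boundaryMatrix]
    | mul a b ha hb => simp [Matrix.mul_apply, ha, hb]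
    | add a b ha hb => simp [ha, hb]
  ext i j
  fin_cases i <;> fin_cases j <;> simp [h, boundary]

lemma boundary_ι (g : G) : boundary deg dgen (FreeAlgebra.ι K g) = dgen g := by
  simp [boundary, boundaryMatrix]

lemma boundary_algebraMap (k : K) : boundary deg dgen (algebraMap K _ k) = 0 := by
  simp [boundary, Matrix.algebraMap_matrix_apply]

lemma boundary_mul (x y : FreeAlgebra K G) :
    boundary deg dgen (x * y) = boundary deg dgen x * y + sign deg x * boundary deg dgen y := by
  have h := congrFun (congrFun (map_mul (boundaryMatrix deg dgen) x y) 0) 1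
  simp only [boundaryMatrix_eq] at h
  simp [Matrix.mul_apply] at h
  rw [h, add_comm]

section

variable {deg dgen}

lemma boundary_word (h0 : ∀ g, deg g = 0 → dgen g = 0)
    (h1 : ∀ g n, deg g = n + 1 → dgen g ∈ component K deg n) (l : List G) :
    ((l.map deg).sum = 0 → boundary deg dgen (l.map (FreeAlgebra.ι K)).prod = 0) ∧
    ∀ n, (l.map deg).sum = n + 1 →
      boundary deg dgen (l.map (FreeAlgebra.ι K)).prod ∈ component K deg n := by
  induction l with
  | nil =>
    have : boundary deg dgen (1 : FreeAlgebra K G) = 0 := by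
      simpa using boundary_algebraMap deg dgen (1 : K)
    simp [this]
  | cons g l ih =>
    simp only [List.map_cons, List.prod_cons, List.sum_cons, boundary_mul, boundary_ι,
      sign_of_mem deg (ι_mem deg g)]
    refine ⟨fun h => ?_, fun n h => ?_⟩
    · rw [h0 g (by omega), ih.1 (by omega)]; simp
    · refine add_mem ?_ ?_
      · rcases hg : deg g with _ | m
        · rw [h0 g hg, zero_mul]; exact zero_mem _
        · have := SetLike.mul_mem_graded (h1 g m hg) (word_mem (K := K) deg l)
          rwa [show m + (l.map deg).sum = n by omega] at this
      · rcases hl : (l.map deg).sum with _ | m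
        · rw [ih.1 hl, mul_zero]; exact zero_mem _
        · have := SetLike.mul_mem_graded (Submodule.smul_mem _ ((-1 : K) ^ deg g)
            (ι_mem (K := K) deg g)) (ih.2 m hl)
          rwa [show deg g + m = n by omega] at this

lemma boundary_zero (h0 : ∀ g, deg g = 0 → dgen g = 0)
    (h1 : ∀ g n, deg g = n + 1 → dgen g ∈ component K deg n) {x : FreeAlgebra K G}
    (hx : x ∈ component K deg 0) : boundary deg dgen x = 0 := by
  induction hx using Submodule.span_induction with
  | mem x h => obtain ⟨l, h, rfl⟩ := h; exact (boundary_word h0 h1 l).1 h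
  | zero => simp
  | add x y _ _ hx hy => rw [map_add, hx, hy, add_zero]
  | smul k x _ hx => rw [map_smul, hx, smul_zero]

lemma boundary_succ (h0 : ∀ g, deg g = 0 → dgen g = 0)
    (h1 : ∀ g n, deg g = n + 1 → dgen g ∈ component K deg n) {n : ℕ} {x : FreeAlgebra K G}
    (hx : x ∈ component K deg (n + 1)) : boundary deg dgen x ∈ component K deg n := by
  induction hx using Submodule.span_induction with
  | mem x h => obtain ⟨l, h, rfl⟩ := h; exact (boundary_word h0 h1 l).2 n h
  | zero => simp
  | add x y _ _ hx hy => rw [map_add]; exact add_mem hx hy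
  | smul k x _ hx => rw [map_smul]; exact Submodule.smul_mem _ _ hx

lemma boundary_sign (h0 : ∀ g, deg g = 0 → dgen g = 0)
    (h1 : ∀ g n, deg g = n + 1 → dgen g ∈ component K deg n) (x : FreeAlgebra K G) :
    boundary deg dgen (sign deg x) = -sign deg (boundary deg dgen x) := by
  induction x with
  | grade0 k => rw [AlgHom.commutes, boundary_algebraMap, map_zero, neg_zero]
  | grade1 g =>
    rw [sign_of_mem deg (ι_mem deg g), map_smul, boundary_ι]
    rcases hg : deg g with _ | n
    · rw [h0 g hg]; simp
    · rw [sign_of_mem deg (h1 g n hg), pow_succ]; simp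
  | mul a b ha hb => simp only [boundary_mul, map_mul, map_add, ha, hb]; noncomm_ring
  | add a b ha hb => simp only [map_add, ha, hb]; abel

lemma boundary_boundary (h0 : ∀ g, deg g = 0 → dgen g = 0)
    (h1 : ∀ g n, deg g = n + 1 → dgen g ∈ component K deg n)
    (h2 : ∀ g, boundary deg dgen (dgen g) = 0) (x : FreeAlgebra K G) :
    boundary deg dgen (boundary deg dgen x) = 0 := by
  induction x with
  | grade0 k => rw [boundary_algebraMap, map_zero]
  | grade1 g => rw [boundary_ι, h2]
  | mul a b ha hb =>
    simp only [boundary_mul, map_add, ha, hb, boundary_sign h0 h1]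
    noncomm_ring
  | add a b ha hb => simp only [map_add, ha, hb, add_zero]

end

variable {K' : Type} [CommRing K'] [Algebra K K'] {G' : Type u}

/-- The homomorphism of free algebras induced by a map of generators and by `K → K'`. -/
def push (K K' : Type) [CommRing K] [CommRing K'] [Algebra K K'] {G G' : Type u} (m : G → G') :
    FreeAlgebra K G →ₐ[K] FreeAlgebra K' G' :=
  FreeAlgebra.lift K fun g => FreeAlgebra.ι K' (m g)

@[simp] lemma push_ι (m : G → G') (g : G) :
    push K K' m (FreeAlgebra.ι K g) = FreeAlgebra.ι K' (m g) := by
  simp [push]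

lemma push_push {K'' : Type} [CommRing K''] [Algebra K K''] [Algebra K' K'']
    [IsScalarTower K K' K''] {G'' : Type u} (m : G → G') (m' : G' → G'') (x : FreeAlgebra K G) :
    push K' K'' m' (push K K' m x) = push K K'' (m' ∘ m) x := by
  induction x with
  | grade0 k =>
    rw [AlgHom.commutes, AlgHom.commutes, IsScalarTower.algebraMap_apply K K' (FreeAlgebra K' G'),
      AlgHom.commutes, ← IsScalarTower.algebraMap_apply K K' (FreeAlgebra K'' G'')]
  | grade1 g => simp
  | mul a b ha hb => simp [ha, hb]
  | add a b ha hb => simp [ha, hb]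

lemma push_injective (m : G → G') (hm : Function.Injective m) :
    Function.Injective (push K K m) := by
  classical
  let r : FreeAlgebra K G' →ₐ[K] FreeAlgebra K G :=
    FreeAlgebra.lift K fun g' => if h : ∃ g, m g = g' then FreeAlgebra.ι K h.choose else 0
  have hr : ∀ x, r (push K K m x) = x := by
    intro x
    have : r.comp (push K K m) = AlgHom.id K _ := by
      ext g
      have h : ∃ g', m g' = m g := ⟨g, rfl⟩
      simp only [Function.comp_apply, AlgHom.comp_apply, push_ι, r, FreeAlgebra.lift_ι_apply,
        dif_pos h, AlgHom.id_apply]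
      rw [hm h.choose_spec]
    exact DFunLike.congr_fun this x
  exact Function.LeftInverse.injective hr

section

variable {deg dgen} {deg' : G' → ℕ} {dgen' : G' → FreeAlgebra K' G'} {m : G → G'}

lemma push_mem (hdeg : ∀ g, deg' (m g) = deg g) {n : ℕ} {x : FreeAlgebra K G}
    (hx : x ∈ component K deg n) : push K K' m x ∈ component K' deg' n := by
  induction hx using Submodule.span_induction with
  | mem x h =>
    obtain ⟨l, rfl, rfl⟩ := h
    have h1 := word_mem (K := K') deg' (l.map m)
    have h2 : ((l.map m).map deg').sum = (l.map deg).sum := by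
      rw [List.map_map]; congr 1; exact List.map_congr_left fun g _ => hdeg g
    rw [h2] at h1
    convert h1 using 1
    rw [map_list_prod, List.map_map, List.map_map]
    congr 1
    exact List.map_congr_left fun g _ => by simp
  | zero => simp
  | add x y _ _ hx hy => rw [map_add]; exact add_mem hx hy
  | smul k x _ hx =>
    rw [map_smul, ← algebraMap_smul K' k]; exact Submodule.smul_mem _ _ hx

lemma push_sign (hdeg : ∀ g, deg' (m g) = deg g) (x : FreeAlgebra K G) :
    push K K' m (sign deg x) = sign deg' (push K K' m x) := by
  induction x with
  | grade0 k =>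
    rw [AlgHom.commutes, AlgHom.commutes, IsScalarTower.algebraMap_apply K K' (FreeAlgebra K' G'),
      AlgHom.commutes]
  | grade1 g =>
    rw [sign_of_mem deg (ι_mem deg g), map_smul, push_ι, sign_of_mem deg' (ι_mem deg' (m g)),
      hdeg, ← algebraMap_smul K', map_pow, map_neg, map_one]
  | mul a b ha hb => simp [ha, hb]
  | add a b ha hb => simp [ha, hb]

lemma push_boundary (hdeg : ∀ g, deg' (m g) = deg g)
    (hd : ∀ g, dgen' (m g) = push K K' m (dgen g)) (x : FreeAlgebra K G) :
    push K K' m (boundary deg dgen x) = boundary deg' dgen' (push K K' m x) := by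
  induction x with
  | grade0 k =>
    rw [AlgHom.commutes, IsScalarTower.algebraMap_apply K K' (FreeAlgebra K' G'),
      boundary_algebraMap, boundary_algebraMap, map_zero]
  | grade1 g => rw [boundary_ι, push_ι, boundary_ι, hd]
  | mul a b ha hb => simp only [boundary_mul, map_add, map_mul, ha, hb, push_sign hdeg]
  | add a b ha hb => simp only [map_add, ha, hb]

end

end FreeGraded

/-- Generators of a free chain algebra over `A`: a graded set, with prescribed boundaries and
prescribed images in `A`. -/
structure Cells (K : Type) [CommRing K] (A : Type u) where
  gen : Type u
  deg : gen → ℕ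
  bd : gen → FreeAlgebra K gen
  aug : gen → A

namespace Cells

open FreeGraded

section

variable {K : Type} [CommRing K] {A : Type u} [Ring A] [Algebra K A]

/-- The differential of the free algebra on the generators. -/
def D (S : Cells K A) : FreeAlgebra K S.gen →ₗ[K] FreeAlgebra K S.gen := boundary S.deg S.bd

/-- The map from the free algebra on the generators to `A`. -/
def E (S : Cells K A) : FreeAlgebra K S.gen →ₐ[K] A := FreeAlgebra.lift K S.aug

/-- The cycles of degree `n` that are zero in `A`. -/
def Cycle (S : Cells K A) (n : ℕ) : Type u :=
  {z : FreeAlgebra K S.gen // z ∈ component K S.deg n ∧ S.D z = 0 ∧ S.E z = 0}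

/-- Adjoin, for each cycle `z` of degree `n` that is zero in `A`, a generator of degree `n + 1`
with boundary `z`. -/
def attach (S : Cells K A) (n : ℕ) : Cells K A where
  gen := S.gen ⊕ S.Cycle n
  deg := Sum.elim S.deg fun _ => n + 1
  bd := Sum.elim (fun g => push K K Sum.inl (S.bd g)) fun z => push K K Sum.inl z.1
  aug := Sum.elim S.aug fun _ => 0

/-- Generators of degree `≤ n`: start with one generator of degree `0` for each element of `A`,
then kill the cycles of degrees `0, …, n - 1` one degree after the other. -/
def stage (K : Type) [CommRing K] (A : Type u) [Ring A] [Algebra K A] : ℕ → Cells K A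
  | 0 => { gen := A, deg := fun _ => 0, bd := fun _ => 0, aug := id }
  | n + 1 => (stage K A n).attach n

/-- All generators of `stage K A n` are of the form `a ∈ A`, or a cycle at an earlier stage. -/
def toLimit (K : Type) [CommRing K] (A : Type u) [Ring A] [Algebra K A] :
    ∀ n, (stage K A n).gen → A ⊕ Σ k, (stage K A k).Cycle k
  | 0 => Sum.inl
  | n + 1 => Sum.elim (toLimit K A n) fun z => Sum.inr ⟨n, z⟩

/-- The union of the stages. -/
def limit (K : Type) [CommRing K] (A : Type u) [Ring A] [Algebra K A] : Cells K A where
  gen := A ⊕ Σ k, (stage K A k).Cycle k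
  deg := Sum.elim (fun _ => 0) fun z => z.1 + 1
  bd := Sum.elim (fun _ => 0) fun z => push K K (toLimit K A z.1) z.2.1
  aug := Sum.elim id fun _ => 0

end

section

variable {K K' : Type} [CommRing K] [CommRing K'] [Algebra K K']
  {A A' : Type u} [Ring A] [Algebra K A] [Ring A'] [Algebra K' A']

/-- A map of generators that is compatible with degrees, boundaries and augmentations. -/
structure Hom (f : A →+* A') (S : Cells K A) (S' : Cells K' A') where
  map : S.gen → S'.gen
  deg_map : ∀ g, S'.deg (map g) = S.deg g
  bd_map : ∀ g, S'.bd (map g) = push K K' map (S.bd g)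
  aug_map : ∀ g, S'.aug (map g) = f (S.aug g)

variable {f : A →+* A'} {S : Cells K A} {S' : Cells K' A'}

lemma Hom.D_push (m : Hom f S S') (x : FreeAlgebra K S.gen) :
    S'.D (push K K' m.map x) = push K K' m.map (S.D x) :=
  (push_boundary m.deg_map m.bd_map x).symm

lemma Hom.E_push (m : Hom f S S')
    (hf : ∀ k, f (algebraMap K A k) = algebraMap K' A' (algebraMap K K' k))
    (x : FreeAlgebra K S.gen) :
    S'.E (push K K' m.map x) = f (S.E x) := by
  induction x with
  | grade0 k =>
    rw [AlgHom.commutes, AlgHom.commutes, IsScalarTower.algebraMap_apply K K' (FreeAlgebra K' _),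
      AlgHom.commutes, hf]
  | grade1 g => simp [E, m.aug_map]
  | mul a b ha hb => simp [ha, hb]
  | add a b ha hb => simp [ha, hb]

variable (hf : ∀ k, f (algebraMap K A k) = algebraMap K' A' (algebraMap K K' k))

/-- The image of a cycle. -/
def Hom.cycle (m : Hom f S S')
    (hf : ∀ k, f (algebraMap K A k) = algebraMap K' A' (algebraMap K K' k))
    (n : ℕ) (z : S.Cycle n) : S'.Cycle n :=
  ⟨push K K' m.map z.1, push_mem m.deg_map z.2.1, by rw [m.D_push, z.2.2.1, map_zero],
    by rw [m.E_push hf, z.2.2.2, map_zero]⟩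

/-- Functoriality of `attach`. -/
def Hom.attach (m : Hom f S S')
    (hf : ∀ k, f (algebraMap K A k) = algebraMap K' A' (algebraMap K K' k))
    (n : ℕ) : Hom f (S.attach n) (S'.attach n) where
  map := Sum.map m.map (m.cycle hf n)
  deg_map g := by
    rcases g with g | z
    · exact m.deg_map g
    · rfl
  bd_map g := by
    rcases g with g | z
    · change push K' K' Sum.inl (S'.bd (m.map g)) = push K K' _ (push K K Sum.inl (S.bd g))
      rw [m.bd_map, push_push, push_push]
      rfl
    · change push K' K' Sum.inl (push K K' m.map z.1) = push K K' _ (push K K Sum.inl z.1)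
      rw [push_push, push_push]
      rfl
  aug_map g := by
    rcases g with g | z
    · exact m.aug_map g
    · exact (map_zero f).symm

/-- Functoriality of `stage`. -/
def stageMap (f : A →+* A')
    (hf : ∀ k, f (algebraMap K A k) = algebraMap K' A' (algebraMap K K' k)) :
    ∀ n, Hom f (stage K A n) (stage K' A' n)
  | 0 => { map := f, deg_map := fun _ => rfl, bd_map := fun _ => (map_zero _).symm,
           aug_map := fun _ => rfl }
  | n + 1 => (stageMap f hf n).attach hf n

/-- Functoriality of `limit`, on generators. -/
def limitMapGen (f : A →+* A')
    (hf : ∀ k, f (algebraMap K A k) = algebraMap K' A' (algebraMap K K' k)) :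
    (limit K A).gen → (limit K' A').gen :=
  Sum.map f fun z => ⟨z.1, (stageMap f hf z.1).cycle hf z.1 z.2⟩

lemma toLimit_stageMap (n : ℕ) (g : (stage K A n).gen) :
    toLimit K' A' n ((stageMap f hf n).map g) = limitMapGen f hf (toLimit K A n g) := by
  induction n with
  | zero => rfl
  | succ n ih =>
    rcases g with g | z
    · exact ih g
    · rfl

/-- Functoriality of `limit`. -/
def limitMap (f : A →+* A')
    (hf : ∀ k, f (algebraMap K A k) = algebraMap K' A' (algebraMap K K' k)) :
    Hom f (limit K A) (limit K' A') where
  map := limitMapGen f hf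
  deg_map g := by rcases g with g | ⟨n, z⟩ <;> rfl
  bd_map g := by
    rcases g with g | ⟨n, z⟩
    · exact (map_zero _).symm
    · change push K' K' (toLimit K' A' n) (push K K' (stageMap f hf n).map z.1) =
        push K K' _ (push K K (toLimit K A n) z.1)
      exact (push_push _ _ _).trans (Eq.trans (congrArg (fun m => push K K' m z.1)
        (funext fun g => toLimit_stageMap hf n g)) (push_push _ _ _).symm)
  aug_map g := by
    rcases g with g | ⟨n, z⟩
    · rfl
    · exact (map_zero f).symm

end

end Cells


/-- A chain algebra over `K`: a graded algebra `⨁ₙ gr n`, `n ≥ 0`, with a differential of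
degree `-1` that satisfies the Leibniz rule. -/
structure ChainAlgebra (K : Type) [CommRing K] where
  carrier : Type u
  [ring : Ring carrier]
  [algebra : Algebra K carrier]
  gr : ℕ → Submodule K carrier
  [graded : GradedAlgebra gr]
  d : carrier →ₗ[K] carrier
  d_zero : ∀ x ∈ gr 0, d x = 0
  d_succ : ∀ n, ∀ x ∈ gr (n + 1), d x ∈ gr n
  d_d : ∀ x, d (d x) = 0
  leibniz : ∀ n, ∀ x ∈ gr n, ∀ y, d (x * y) = d x * y + (-1 : K) ^ n • (x * d y)

attribute [instance] ChainAlgebra.ring ChainAlgebra.algebra ChainAlgebra.graded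

/-- A chain algebra over `K` with a morphism `ε` of chain algebras to the algebra `A`, which is
regarded as a chain algebra concentrated in degree `0`. -/
structure ChainAlgebraOver (K : Type) [CommRing K] (A : Type u) [Ring A] [Algebra K A]
    extends ChainAlgebra.{u} K where
  ε : carrier →ₐ[K] A
  ε_pos : ∀ n, ∀ x ∈ gr (n + 1), ε x = 0
  ε_d : ∀ x, ε (d x) = 0

namespace ChainAlgebra

variable {K : Type} [CommRing K] (R : ChainAlgebra.{u} K)

/-- The underlying graded algebra is free: it is the tensor algebra of a free graded module, or
equivalently the free algebra on a set of homogeneous elements. -/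
def IsQuasiFree : Prop :=
  ∃ (X : Type u) (deg : X → ℕ) (g : X → R.carrier), (∀ x, g x ∈ R.gr (deg x)) ∧
    Function.Bijective (FreeAlgebra.lift K g)

/-- The linear map that is `x ↦ (-1) ^ n * x` on elements of degree `n`. -/
def sign : R.carrier →ₗ[K] R.carrier :=
  DirectSum.toModule K ℕ R.carrier (fun n => (-1 : K) ^ n • (R.gr n).subtype) ∘ₗ
    (DirectSum.decomposeLinearEquiv R.gr).toLinearMap

lemma sign_of_mem {n : ℕ} {x : R.carrier} (hx : x ∈ R.gr n) : R.sign x = (-1 : K) ^ n • x := by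
  rw [sign, LinearMap.comp_apply, LinearEquiv.coe_coe, DirectSum.decomposeLinearEquiv_apply,
    DirectSum.decompose_of_mem R.gr hx]
  erw [DirectSum.toModule_lof]
  rfl

end ChainAlgebra

namespace ChainAlgebraOver

/-- The morphism `ε` is a weak equivalence, i.e. it induces an isomorphism in homology. -/
structure IsWeakEquivalence {K : Type} [CommRing K] {A : Type u} [Ring A] [Algebra K A]
    (P : ChainAlgebraOver K A) : Prop where
  surjective : ∀ a, ∃ x ∈ P.gr 0, P.ε x = a
  injective : ∀ x ∈ P.gr 0, P.ε x = 0 → ∃ y ∈ P.gr 1, P.d y = x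
  exact : ∀ n, ∀ x ∈ P.gr (n + 1), P.d x = 0 → ∃ y ∈ P.gr (n + 2), P.d y = x

variable {K K' : Type} [CommRing K] [CommRing K'] [Algebra K K']
  {A A' : Type u} [Ring A] [Algebra K A] [Ring A'] [Algebra K' A']

/-- Morphisms of chain algebras, over the structure map `K → K'` and a map `f : A → A'`. -/
structure Hom (f : A →+* A') (P : ChainAlgebraOver K A) (P' : ChainAlgebraOver K' A') where
  toRingHom : P.carrier →+* P'.carrier
  map_smul : ∀ (k : K) x, toRingHom (k • x) = algebraMap K K' k • toRingHom x
  map_gr : ∀ n, ∀ x ∈ P.gr n, toRingHom x ∈ P'.gr n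
  map_d : ∀ x, toRingHom (P.d x) = P'.d (toRingHom x)
  map_ε : ∀ x, P'.ε (toRingHom x) = f (P.ε x)

end ChainAlgebraOver

section Resolution

open FreeGraded Cells

variable (K : Type) [CommRing K] (A : Type u) [Ring A] [Algebra K A]

namespace Cells

/-- The inclusion of a stage into the union. -/
def toLimitHom (n : ℕ) : Hom (RingHom.id A) (stage K A n) (limit K A) where
  map := toLimit K A n
  deg_map g := by
    induction n with
    | zero => rfl
    | succ n ih => rcases g with g | z; exacts [ih g, rfl]
  bd_map g := by
    induction n with
    | zero => exact (map_zero _).symm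
    | succ n ih =>
      rcases g with g | z
      · exact (ih g).trans (push_push (K := K) (K' := K) Sum.inl (toLimit K A (n + 1)) _).symm
      · exact (push_push (K := K) (K' := K) Sum.inl (toLimit K A (n + 1)) z.1).symm
  aug_map g := by
    induction n with
    | zero => rfl
    | succ n ih => rcases g with g | z; exacts [ih g, rfl]

lemma toLimit_injective (n : ℕ) : Function.Injective (toLimit K A n) := by
  have hlt : ∀ n g k z, toLimit K A n g = Sum.inr ⟨k, z⟩ → k < n := by
    intro n
    induction n with
    | zero => intro g k z h; cases h
    | succ n ih =>
      rintro (g | w) k z h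
      · exact (ih g k z h).trans n.lt_succ_self
      · change Sum.inr (⟨n, w⟩ : Σ k, (stage K A k).Cycle k) = _ at h
        cases h; exact n.lt_succ_self
  induction n with
  | zero => exact Sum.inl_injective
  | succ n ih =>
    rintro (g | w) (g' | w') h
    · exact congrArg _ (ih h)
    · exact absurd (hlt n g n w' h) (lt_irrefl n)
    · exact absurd (hlt n g' n w h.symm) (lt_irrefl n)
    · change Sum.inr (⟨n, w⟩ : Σ k, (stage K A k).Cycle k) = Sum.inr ⟨n, w'⟩ at h
      cases h; rfl

lemma exists_toLimit (n : ℕ) (g : (limit K A).gen) (hg : (limit K A).deg g ≤ n) :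
    ∃ g', (toLimitHom K A n).map g' = g := by
  induction n with
  | zero =>
    rcases g with a | ⟨k, z⟩
    · exact ⟨a, rfl⟩
    · change k + 1 ≤ 0 at hg; omega
  | succ n ih =>
    by_cases h : (limit K A).deg g ≤ n
    · obtain ⟨g', rfl⟩ := ih h; exact ⟨Sum.inl g', rfl⟩
    · rcases g with a | ⟨k, z⟩
      · exact absurd (Nat.zero_le n) h
      · change k + 1 ≤ n + 1 at hg
        change ¬ k + 1 ≤ n at h
        obtain rfl : k = n := by omega
        exact ⟨Sum.inr z, rfl⟩

lemma exists_push (n : ℕ) {x : FreeAlgebra K (limit K A).gen}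
    (hx : x ∈ component K (limit K A).deg n) :
    ∃ y ∈ component K (stage K A n).deg n, push K K ((toLimitHom K A n).map) y = x := by
  induction hx using Submodule.span_induction with
  | mem x h =>
    obtain ⟨l, hl, rfl⟩ := h
    have h1 : ∀ g ∈ l, ∃ g', (toLimitHom K A n).map g' = g := fun g hg =>
      exists_toLimit K A n g (hl ▸ List.single_le_sum (fun _ _ => Nat.zero_le _) _
        (List.mem_map_of_mem hg))
    obtain ⟨l', rfl⟩ : ∃ l' : List (stage K A n).gen, l'.map ((toLimitHom K A n).map) = l := by
      clear hl
      induction l with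
      | nil => exact ⟨[], rfl⟩
      | cons g l ih =>
        obtain ⟨l', rfl⟩ := ih fun g hg => h1 g (List.mem_cons_of_mem _ hg)
        obtain ⟨g', rfl⟩ := h1 g List.mem_cons_self
        exact ⟨g' :: l', rfl⟩
    refine ⟨(l'.map (FreeAlgebra.ι K)).prod, Submodule.subset_span ⟨l', ?_, rfl⟩, ?_⟩
    · refine Eq.trans ?_ hl
      rw [List.map_map]
      congr 1
      exact List.map_congr_left fun g _ => ((toLimitHom K A n).deg_map g).symm
    · rw [map_list_prod, List.map_map, List.map_map]
      congr 1
      exact List.map_congr_left fun g _ => by simp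
  | zero => exact ⟨0, zero_mem _, map_zero _⟩
  | add x y _ _ hx hy =>
    obtain ⟨x', hx', rfl⟩ := hx
    obtain ⟨y', hy', rfl⟩ := hy
    exact ⟨x' + y', add_mem hx' hy', map_add _ _ _⟩
  | smul k x _ hx =>
    obtain ⟨x', hx', rfl⟩ := hx
    exact ⟨k • x', Submodule.smul_mem _ _ hx', map_smul _ _ _⟩

lemma limit_bd_zero (g : (limit K A).gen) (hg : (limit K A).deg g = 0) :
    (limit K A).bd g = 0 := by
  rcases g with a | ⟨k, z⟩
  · rfl
  · change k + 1 = 0 at hg; omega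

lemma limit_bd_succ (g : (limit K A).gen) (n : ℕ) (hg : (limit K A).deg g = n + 1) :
    (limit K A).bd g ∈ component K (limit K A).deg n := by
  rcases g with a | ⟨k, z⟩
  · change 0 = n + 1 at hg; omega
  · change k + 1 = n + 1 at hg
    obtain rfl : k = n := by omega
    exact push_mem (toLimitHom K A k).deg_map z.2.1

lemma limit_D_bd (g : (limit K A).gen) : (limit K A).D ((limit K A).bd g) = 0 := by
  rcases g with a | ⟨k, z⟩
  · exact map_zero _
  · exact ((toLimitHom K A k).D_push z.1).trans (by rw [z.2.2.1, map_zero])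

lemma limit_E_bd (g : (limit K A).gen) : (limit K A).E ((limit K A).bd g) = 0 := by
  rcases g with a | ⟨k, z⟩
  · exact map_zero _
  · exact ((toLimitHom K A k).E_push (fun _ => rfl) z.1).trans (by rw [z.2.2.2, map_zero])

end Cells

/-- The canonical quasi-free chain algebra that is weakly equivalent to `A`: the free algebra
on the generators `Cells.limit K A`. -/
def quasiFreeReplacement : ChainAlgebraOver K A where
  carrier := FreeAlgebra K (limit K A).gen
  gr := component K (limit K A).deg
  d := (limit K A).D
  d_zero _ hx := boundary_zero (limit_bd_zero K A) (limit_bd_succ K A) hx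
  d_succ _ _ hx := boundary_succ (limit_bd_zero K A) (limit_bd_succ K A) hx
  d_d x := boundary_boundary (limit_bd_zero K A) (limit_bd_succ K A) (limit_D_bd K A) x
  leibniz n x hx y := by
    rw [Cells.D, boundary_mul, FreeGraded.sign_of_mem _ hx, smul_mul_assoc]
  ε := (limit K A).E
  ε_pos n x hx := by
    induction hx using Submodule.span_induction with
    | mem x h =>
      obtain ⟨l, hl, rfl⟩ := h
      obtain ⟨g, hg, h0⟩ : ∃ g ∈ l, (limit K A).deg g ≠ 0 := by
        by_contra! h
        rw [List.sum_eq_zero (by simpa using h)] at hl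
        omega
      rw [map_list_prod, List.map_map]
      refine List.prod_eq_zero (List.mem_map.2 ⟨g, hg, ?_⟩)
      rw [Function.comp_apply, Cells.E, FreeAlgebra.lift_ι_apply]
      rcases g with a | z
      · exact absurd rfl h0
      · rfl
    | zero => simp
    | add x y _ _ hx hy => rw [map_add, hx, hy, add_zero]
    | smul k x _ hx => rw [map_smul, hx, smul_zero]
  ε_d x := by
    induction x with
    | grade0 k => rw [Cells.D, boundary_algebraMap, map_zero]
    | grade1 g => rw [Cells.D, boundary_ι, limit_E_bd]
    | mul a b ha hb =>
      rw [Cells.D] at *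
      rw [boundary_mul, map_add, map_mul, map_mul, ha, hb, zero_mul, mul_zero, add_zero]
    | add a b ha hb => rw [map_add, map_add, ha, hb, add_zero]

theorem quasiFreeReplacement_isQuasiFree : (quasiFreeReplacement K A).IsQuasiFree := by
  refine ⟨(limit K A).gen, (limit K A).deg, FreeAlgebra.ι K, fun g => ι_mem _ g, ?_⟩
  have : FreeAlgebra.lift K (FreeAlgebra.ι K) = AlgHom.id K (FreeAlgebra K (limit K A).gen) := by
    ext g; simp
  change Function.Bijective (FreeAlgebra.lift K (FreeAlgebra.ι K (X := (limit K A).gen)))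
  rw [this]
  exact Function.bijective_id

theorem quasiFreeReplacement_isWeakEquivalence :
    (quasiFreeReplacement K A).IsWeakEquivalence := by
  have key : ∀ n, ∀ x ∈ component K (limit K A).deg n, (limit K A).D x = 0 →
      (limit K A).E x = 0 →
      ∃ y ∈ component K (limit K A).deg (n + 1), (limit K A).D y = x := by
    intro n x hx hD hE
    obtain ⟨y, hy, rfl⟩ := exists_push K A n hx
    have h1 : (stage K A n).D y = 0 := by
      refine push_injective _ (toLimit_injective K A n) ?_
      rw [map_zero]
      exact ((toLimitHom K A n).D_push y).symm.trans hD
    have h2 : (stage K A n).E y = 0 :=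
      ((toLimitHom K A n).E_push (fun _ => rfl) y).symm.trans hE
    let g : (limit K A).gen := Sum.inr ⟨n, y, hy, h1, h2⟩
    exact ⟨FreeAlgebra.ι K g, ι_mem (limit K A).deg g, boundary_ι _ _ g⟩
  refine ⟨fun a => ?_, fun x hx h => ?_, fun n x hx h => ?_⟩
  · let g : (limit K A).gen := Sum.inl a
    exact ⟨FreeAlgebra.ι K g, ι_mem (limit K A).deg g, FreeAlgebra.lift_ι_apply _ g⟩
  · exact key 0 x hx ((quasiFreeReplacement K A).d_zero x hx) h
  · exact key (n + 1) x hx h ((quasiFreeReplacement K A).ε_pos n x hx)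

variable {K A} {K' : Type} [CommRing K'] [Algebra K K'] {A' : Type u} [Ring A'] [Algebra K' A']

/-- Functoriality of the canonical replacement in the ground ring and in the algebra. -/
def quasiFreeReplacementMap (f : A →+* A')
    (hf : ∀ k, f (algebraMap K A k) = algebraMap K' A' (algebraMap K K' k)) :
    ChainAlgebraOver.Hom f (quasiFreeReplacement K A) (quasiFreeReplacement K' A') where
  toRingHom := (push K K' (limitMap f hf).map).toRingHom
  map_smul k x := by
    refine (map_smul (push K K' (limitMap f hf).map) k x).trans ?_
    exact (algebraMap_smul K' k (push K K' (limitMap f hf).map x)).symm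
  map_gr _ _ hx := push_mem (limitMap f hf).deg_map hx
  map_d x := ((limitMap f hf).D_push x).symm
  map_ε x := (limitMap f hf).E_push hf x

end Resolution

/-- Morphisms of bimodules over a ring homomorphism `f : A → A'`: maps `φ : M' → M` with
`φ (f a * m) = a * φ m` and `φ (m * f a) = φ m * a`, i.e. bimodule maps `f^* M' → M`. -/
structure BimoduleHom {A A' : Type u} [Ring A] [Ring A'] (f : A →+* A') (M' M : Type v)
    [AddCommGroup M'] [Module A' M'] [Module A'ᵐᵒᵖ M']
    [AddCommGroup M] [Module A M] [Module Aᵐᵒᵖ M] where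
  toAddMonoidHom : M' →+ M
  map_left : ∀ a m, toAddMonoidHom (f a • m) = a • toAddMonoidHom m
  map_right : ∀ a m, toAddMonoidHom (MulOpposite.op (f a) • m) =
    MulOpposite.op a • toAddMonoidHom m

/-- The identity of a bimodule. -/
def BimoduleHom.id {A : Type u} [Ring A] (M : Type v)
    [AddCommGroup M] [Module A M] [Module Aᵐᵒᵖ M] : BimoduleHom (RingHom.id A) M M where
  toAddMonoidHom := AddMonoidHom.id M
  map_left _ _ := rfl
  map_right _ _ := rfl

namespace ChainAlgebraOver

open MulOpposite

section

variable {K : Type} [CommRing K] {A : Type u} [Ring A] [Algebra K A]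
  (P : ChainAlgebraOver K A) (M : Type v) [AddCommGroup M] [Module A M] [Module Aᵐᵒᵖ M]

/-- Families of functions of `n` variables in `P` with values in `M`, for `n ≥ 0`. -/
abbrev Family : Type (max u v) := ∀ n : ℕ, (Fin n → P.carrier) → M

/-- The cochains of degree `m` of the total complex of the bicomplex `Hom (P^{⊗ n}, M)`: families
of `K`-multilinear maps `f n`, such that `f n` vanishes on `x₁ ⊗ ⋯ ⊗ xₙ` unless
`|x₁| + ⋯ + |xₙ| + n = m`. -/
def cochains (m : ℕ) : AddSubgroup (P.Family M) where
  carrier := {f |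
    (∀ n (r : Fin n → P.carrier) (i : Fin n) (x y : P.carrier),
      f n (Function.update r i (x + y)) =
        f n (Function.update r i x) + f n (Function.update r i y)) ∧
    (∀ n (r : Fin n → P.carrier) (i : Fin n) (k : K) (x : P.carrier),
      f n (Function.update r i (k • x)) = algebraMap K A k • f n (Function.update r i x)) ∧
    (∀ n (r : Fin n → P.carrier) (e : Fin n → ℕ), (∀ i, r i ∈ P.gr (e i)) →
      ∑ i, e i + n ≠ m → f n r = 0)}
  zero_mem' := by simp
  add_mem' := by
    rintro f g ⟨h1, h2, h3⟩ ⟨h1', h2', h3'⟩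
    refine ⟨fun n r i x y => ?_, fun n r i k x => ?_, fun n r e hr he => ?_⟩
    · simp only [Pi.add_apply, h1, h1']; abel
    · simp only [Pi.add_apply, h2, h2', smul_add]
    · simp only [Pi.add_apply, h3 n r e hr he, h3' n r e hr he, add_zero]
  neg_mem' := by
    rintro f ⟨h1, h2, h3⟩
    refine ⟨fun n r i x y => ?_, fun n r i k x => ?_, fun n r e hr he => ?_⟩
    · simp only [Pi.neg_apply, h1]; abel
    · simp only [Pi.neg_apply, h2, smul_neg]
    · simp only [Pi.neg_apply, h3 n r e hr he, neg_zero]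

variable {M}

/-- The Hochschild coboundary of `f : P^{⊗ n} → M`. -/
def hochschild {n : ℕ} (f : (Fin n → P.carrier) → M) (r : Fin (n + 1) → P.carrier) : M :=
  P.ε (r 0) • f (Fin.tail r) +
    ∑ i : Fin n, (-1 : ℤ) ^ (i.val + 1) • f (Fin.contractNth i.castSucc (· * ·) r) +
    (-1 : ℤ) ^ (n + 1) • (op (P.ε (r (Fin.last n))) • f (Fin.init r))

/-- The composition of `f : P^{⊗ n} → M` with the differential of the tensor product of complexes
`x₁ ⊗ ⋯ ⊗ xₙ ↦ ∑ᵢ (-1) ^ (|x₁| + ⋯ + |xᵢ₋₁|) x₁ ⊗ ⋯ ⊗ d xᵢ ⊗ ⋯ ⊗ xₙ`. -/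
def internal {n : ℕ} (f : (Fin n → P.carrier) → M) (r : Fin n → P.carrier) : M :=
  ∑ i : Fin n, f fun j => if j < i then P.sign (r j) else if j = i then P.d (r j) else r j

variable (M)

/-- The differential of the total complex. -/
def differential : P.Family M →+ P.Family M where
  toFun f n r := match n, r with
    | 0, _ => 0
    | n + 1, r => P.hochschild (f n) r + (-1 : ℤ) ^ (n + 1) • P.internal (f (n + 1)) r
  map_zero' := by
    funext n r
    cases n <;> simp [hochschild, internal]
  map_add' f g := by
    funext n r
    cases n
    · simp
    · simp only [hochschild, internal, Pi.add_apply, smul_add, Finset.sum_add_distrib]; abel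

/-- The cocycles of degree `m`. -/
def cocycles (m : ℕ) : AddSubgroup (P.Family M) := P.cochains M m ⊓ (P.differential M).ker

/-- The coboundaries of degree `m`. -/
def coboundaries : ℕ → AddSubgroup (P.Family M)
  | 0 => ⊥
  | m + 1 => (P.cochains M m).map (P.differential M)

/-- The Hochschild cohomology `H^m(P, M)` of the chain algebra `P`, with coefficients in an
`A`-bimodule `M`, which is regarded as concentrated in degree `0`. -/
def Hochschild (m : ℕ) : Type (max u v) :=
  P.cocycles M m ⧸ (P.coboundaries M m).addSubgroupOf (P.cocycles M m)

instance (m : ℕ) : AddCommGroup (P.Hochschild M m) :=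
  inferInstanceAs (AddCommGroup
    (P.cocycles M m ⧸ (P.coboundaries M m).addSubgroupOf (P.cocycles M m)))

end

section

variable {K K' : Type} [CommRing K] [CommRing K'] [Algebra K K']
  {A A' : Type u} [Ring A] [Algebra K A] [Ring A'] [Algebra K' A']
  {f : A →+* A'} {P : ChainAlgebraOver K A} {P' : ChainAlgebraOver K' A'}
  {M M' : Type v} [AddCommGroup M] [Module A M] [Module Aᵐᵒᵖ M]
  [AddCommGroup M'] [Module A' M'] [Module A'ᵐᵒᵖ M']

/-- Pullback of families along `u : P → P'` and `φ : M' → M`. -/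
def pullback (u : Hom f P P') (φ : BimoduleHom f M' M) : P'.Family M' →+ P.Family M where
  toFun c n r := φ.toAddMonoidHom (c n fun i => u.toRingHom (r i))
  map_zero' := by funext n r; simp
  map_add' c c' := by funext n r; simp

lemma Hom.map_sign (u : Hom f P P') (x : P.carrier) :
    u.toRingHom (P.sign x) = P'.sign (u.toRingHom x) := by
  induction x using DirectSum.Decomposition.inductionOn P.gr with
  | zero => simp
  | @homogeneous i x =>
    rw [P.sign_of_mem x.2, P'.sign_of_mem (u.map_gr i _ x.2), u.map_smul]
    simp
  | add x y hx hy => simp [hx, hy]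

lemma pullback_mem (u : Hom f P P') (φ : BimoduleHom f M' M)
    (hf : ∀ k, f (algebraMap K A k) = algebraMap K' A' (algebraMap K K' k)) {m : ℕ}
    {c : P'.Family M'} (hc : c ∈ P'.cochains M' m) : pullback u φ c ∈ P.cochains M m := by
  obtain ⟨h1, h2, h3⟩ := hc
  have hu : ∀ n (r : Fin n → P.carrier) (i : Fin n) (x : P.carrier),
      (fun j => u.toRingHom (Function.update r i x j)) =
        Function.update (fun j => u.toRingHom (r j)) i (u.toRingHom x) := by
    intro n r i x
    funext j
    rcases eq_or_ne j i with rfl | h <;> simp [*]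
  refine ⟨fun n r i x y => ?_, fun n r i k x => ?_, fun n r e hr he => ?_⟩
  · simp only [pullback, AddMonoidHom.coe_mk, ZeroHom.coe_mk, hu, map_add, h1]
  · simp only [pullback, AddMonoidHom.coe_mk, ZeroHom.coe_mk, hu, u.map_smul, h2, ← hf,
      φ.map_left]
  · simp only [pullback, AddMonoidHom.coe_mk, ZeroHom.coe_mk]
    rw [h3 n _ e (fun i => u.map_gr _ _ (hr i)) he, map_zero]

lemma pullback_differential (u : Hom f P P') (φ : BimoduleHom f M' M) (c : P'.Family M') :
    P.differential M (pullback u φ c) = pullback u φ (P'.differential M' c) := by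
  funext n r
  cases n with
  | zero => exact (map_zero φ.toAddMonoidHom).symm
  | succ n =>
    simp only [differential, pullback, AddMonoidHom.coe_mk, ZeroHom.coe_mk, hochschild, internal,
      map_add, map_zsmul, map_sum, u.map_ε, φ.map_left, φ.map_right]
    congr 3
    · congr 1
      funext i
      congr 3
      funext j
      simp only [Fin.contractNth]
      split_ifs <;> simp
    · funext i
      congr 2
      funext j
      split_ifs
      · exact u.map_sign _
      · exact u.map_d _
      · rfl

/-- Functoriality of Hochschild cohomology. -/
def Hochschild.map (u : Hom f P P') (φ : BimoduleHom f M' M)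
    (hf : ∀ k, f (algebraMap K A k) = algebraMap K' A' (algebraMap K K' k)) (m : ℕ) :
    P'.Hochschild M' m →+ P.Hochschild M m :=
  QuotientAddGroup.map _ _
    (((pullback u φ).comp (P'.cocycles M' m).subtype).codRestrict (P.cocycles M m) fun c =>
      ⟨pullback_mem u φ hf c.2.1, by
        change P.differential M (pullback u φ c.1) = 0
        rw [pullback_differential, show P'.differential M' c.1 = 0 from c.2.2, map_zero]⟩)
    (by
      rintro ⟨c, hc⟩ h
      change c ∈ P'.coboundaries M' m at h
      change pullback u φ c ∈ P.coboundaries M m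
      cases m with
      | zero =>
        have : c = 0 := h
        rw [this, map_zero]
        exact zero_mem _
      | succ m =>
        obtain ⟨b, hb, rfl⟩ := h
        exact ⟨pullback u φ b, pullback_mem u φ hf hb, pullback_differential u φ b⟩)

end

end ChainAlgebraOver

section Shukla

/-- Shukla cohomology of the `K`-algebra `A` with coefficients in the `A`-bimodule `M`: the
Hochschild cohomology of a quasi-free chain algebra weakly equivalent to `A`. -/
def Shukla (K : Type) [CommRing K] (A : Type u) [Ring A] [Algebra K A]
    (M : Type v) [AddCommGroup M] [Module A M] [Module Aᵐᵒᵖ M] (n : ℕ) : Type (max u v) :=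
  (quasiFreeReplacement K A).Hochschild M n

instance (K : Type) [CommRing K] (A : Type u) [Ring A] [Algebra K A]
    (M : Type v) [AddCommGroup M] [Module A M] [Module Aᵐᵒᵖ M] (n : ℕ) :
    AddCommGroup (Shukla K A M n) :=
  inferInstanceAs (AddCommGroup ((quasiFreeReplacement K A).Hochschild M n))

/-- The functoriality of Shukla cohomology in the ground ring, the algebra and the bimodule. -/
def Shukla.map {K K' : Type} [CommRing K] [CommRing K'] [Algebra K K']
    {A A' : Type u} [Ring A] [Algebra K A] [Ring A'] [Algebra K' A'] {f : A →+* A'}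
    (hf : ∀ k, f (algebraMap K A k) = algebraMap K' A' (algebraMap K K' k))
    {M M' : Type v} [AddCommGroup M] [Module A M] [Module Aᵐᵒᵖ M]
    [AddCommGroup M'] [Module A' M'] [Module A'ᵐᵒᵖ M'] (φ : BimoduleHom f M' M) (n : ℕ) :
    Shukla K' A' M' n →+ Shukla K A M n :=
  ChainAlgebraOver.Hochschild.map (quasiFreeReplacementMap f hf) φ hf n

/-- An algebra over `ℤ/p` is an algebra over `ℤ/p²`, through the projection `ℤ/p² → ℤ/p`. -/
instance zmodSqAlgebra (p : ℕ) (A : Type u) [Ring A] [Algebra (ZMod p) A] :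
    Algebra (ZMod (p ^ 2)) A :=
  Algebra.compHom A (ZMod.castHom (dvd_pow_self p two_ne_zero) (ZMod p))

/-- The base change homomorphism `b^n : Shukla^n(A/(ℤ/p²), M) → Shukla^n(A/ℤ, M)`. -/
def Shukla.baseChange (p : ℕ) (A : Type u) [Ring A] [Algebra (ZMod p) A]
    (M : Type v) [AddCommGroup M] [Module A M] [Module Aᵐᵒᵖ M] (n : ℕ) :
    Shukla (ZMod (p ^ 2)) A M n →+ Shukla ℤ A M n :=
  Shukla.map (K := ℤ) (K' := ZMod (p ^ 2)) (f := RingHom.id A)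
    (fun k => by simp) (BimoduleHom.id M) n

/-- The homomorphism `Shukla^n(A'/ℤ, M') → Shukla^n(A/ℤ, M)` induced by `f` and `φ`. -/
def Shukla.mapInt {A A' : Type u} [Ring A] [Ring A'] {f : A →+* A'}
    {M M' : Type v} [AddCommGroup M] [Module A M] [Module Aᵐᵒᵖ M]
    [AddCommGroup M'] [Module A' M'] [Module A'ᵐᵒᵖ M'] (φ : BimoduleHom f M' M) (n : ℕ) :
    Shukla ℤ A' M' n →+ Shukla ℤ A M n :=
  Shukla.map (K := ℤ) (K' := ℤ) (f := f) (fun k => by simp) φ n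

/-- The homomorphism `Shukla^n(A'/(ℤ/p²), M') → Shukla^n(A/(ℤ/p²), M)` induced by `f` and `φ`. -/
def Shukla.mapZModSq (p : ℕ) {A A' : Type u} [Ring A] [Algebra (ZMod p) A]
    [Ring A'] [Algebra (ZMod p) A'] {f : A →+* A'}
    {M M' : Type v} [AddCommGroup M] [Module A M] [Module Aᵐᵒᵖ M]
    [AddCommGroup M'] [Module A' M'] [Module A'ᵐᵒᵖ M'] (φ : BimoduleHom f M' M) (n : ℕ) :
    Shukla (ZMod (p ^ 2)) A' M' n →+ Shukla (ZMod (p ^ 2)) A M n :=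
  Shukla.map (K := ZMod (p ^ 2)) (K' := ZMod (p ^ 2)) (f := f)
    (fun k => DFunLike.congr_fun (Subsingleton.elim (f.comp (algebraMap (ZMod (p ^ 2)) A))
      (algebraMap (ZMod (p ^ 2)) A')) k) φ n

end Shukla

end

/-! Write `P` and `P'` for the quasi-free replacements of `A` over ℤ and over ℤ/p², and put `T = pP
+ dP₂ + P_{≥2}`, similarly `T'` (`truncationIdeal`). Then `P/T` is the truncation of `P/p` to
degrees 0 and 1. Since `p` kills `M`, cochains on `P` are cochains on the complex of 𝔽_p-vector
spaces `P/p`, and those that vanish as soon as one argument lies in `T` form the Hochschild complex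
of `P/T`. The quotient algebra itself is never formed.

Over ℤ, `P` is torsion free, so `P/p` computes Tor^ℤ(A, 𝔽_p), which is `A` in degrees 0 and 1 and
zero above. Hence `T/pP` is contractible (`exists_contraction_of_torsionFree`), and Shukla^n(A/ℤ, M)
is the cohomology of `P/T` for every `n`. Over ℤ/p² the corresponding Tor groups are `A` in every
degree, and in general `T'/pP'` is contractible only in degrees < 2 (`exists_contraction_two`); this
still makes H^n(P'/T') → Shukla^n(A/(ℤ/p²), M) surjective for n ≤ 2. The passage from a contraction
to cochains is `exists_sub_differential_vanishesOn`.

The two truncations agree: reduction induces P/T ≅ P'/T' (`reduction_surjective`,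
`reduction_injective`). So the composite H^n(P'/T') → Shukla^n(A/(ℤ/p²), M) → Shukla^n(A/ℤ, M) is an
isomorphism, and its inverse followed by the first map splits `b^n`. The splitting is natural
because truncation is functorial. For n ≤ 2 the first map is onto, so the splitting is also a left
inverse of `b^n`. -/

noncomputable section

open MulOpposite

/-! ### Multiadditive functions on tuples -/

section Multiadditive

variable {C : Type u} {M : Type v} [AddCommGroup C] [AddCommGroup M]

/-- Functions of `n` variables that are additive in each variable. -/
def IsMultiadditive {n : ℕ} (f : (Fin n → C) → M) : Prop :=
  ∀ (r : Fin n → C) (i : Fin n) (x y : C),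
    f (Function.update r i (x + y)) = f (Function.update r i x) + f (Function.update r i y)

namespace IsMultiadditive

variable {n : ℕ} {f g : (Fin n → C) → M}

/-- The dependence on one variable. -/
def slot (hf : IsMultiadditive f) (r : Fin n → C) (i : Fin n) : C →+ M :=
  AddMonoidHom.mk' (fun x => f (Function.update r i x)) (hf r i)

lemma update_zero (hf : IsMultiadditive f) (r : Fin n → C) (i : Fin n) :
    f (Function.update r i 0) = 0 := map_zero (hf.slot r i)

lemma update_neg (hf : IsMultiadditive f) (r : Fin n → C) (i : Fin n) (x : C) :
    f (Function.update r i (-x)) = -f (Function.update r i x) := map_neg (hf.slot r i) x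

lemma update_sub (hf : IsMultiadditive f) (r : Fin n → C) (i : Fin n) (x y : C) :
    f (Function.update r i (x - y)) = f (Function.update r i x) - f (Function.update r i y) :=
  map_sub (hf.slot r i) x y

lemma update_zsmul (hf : IsMultiadditive f) (r : Fin n → C) (i : Fin n) (k : ℤ) (x : C) :
    f (Function.update r i (k • x)) = k • f (Function.update r i x) := map_zsmul (hf.slot r i) k x

lemma update_nsmul (hf : IsMultiadditive f) (r : Fin n → C) (i : Fin n) (k : ℕ) (x : C) :
    f (Function.update r i (k • x)) = k • f (Function.update r i x) := map_nsmul (hf.slot r i) k x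

lemma zero : IsMultiadditive (0 : (Fin n → C) → M) := fun _ _ _ _ => by simp

lemma add (hf : IsMultiadditive f) (hg : IsMultiadditive g) : IsMultiadditive (f + g) :=
  fun r i x y => by simp only [Pi.add_apply, hf r i, hg r i]; abel

lemma neg (hf : IsMultiadditive f) : IsMultiadditive (-f) :=
  fun r i x y => by simp only [Pi.neg_apply, hf r i]; abel

lemma sub (hf : IsMultiadditive f) (hg : IsMultiadditive g) : IsMultiadditive (f - g) := by
  rw [sub_eq_add_neg]; exact hf.add hg.neg

lemma zsmul (hf : IsMultiadditive f) (k : ℤ) : IsMultiadditive (k • f) :=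
  fun r i x y => by simp only [Pi.smul_apply, hf r i, smul_add]

lemma sum {ι : Type*} (s : Finset ι) {F : ι → (Fin n → C) → M}
    (hF : ∀ k ∈ s, IsMultiadditive (F k)) : IsMultiadditive fun r => ∑ k ∈ s, F k r :=
  fun r i x y => by
    rw [← Finset.sum_add_distrib]; exact Finset.sum_congr rfl fun k hk => hF k hk r i x y

/-- A multiadditive function vanishes if it vanishes on generators. -/
lemma eq_zero_of_closure (hf : IsMultiadditive f) (X : Fin n → Set C)
    (h : ∀ r, (∀ i, r i ∈ X i) → f r = 0) (r : Fin n → C)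
    (hr : ∀ i, r i ∈ AddSubgroup.closure (X i)) : f r = 0 := by
  -- Induction on the set of slots whose arguments are arbitrary elements of the closure; the other
  -- slots still carry generators.
  have key : ∀ (s : Finset (Fin n)) (r : Fin n → C),
      (∀ i ∈ s, r i ∈ AddSubgroup.closure (X i)) → (∀ i ∉ s, r i ∈ X i) → f r = 0 := by
    intro s
    induction s using Finset.induction_on with
    | empty => intro r _ h'; exact h r fun i => h' i (by simp)
    | insert a s ha ih =>
      intro r h1 h2
      have h3 : ∀ x ∈ AddSubgroup.closure (X a), f (Function.update r a x) = 0 := by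
        intro x hx
        induction hx using AddSubgroup.closure_induction with
        | mem x hx =>
          refine ih _ (fun i hi => ?_) (fun i hi => ?_)
          · rw [Function.update_of_ne (by rintro rfl; exact ha hi)]
            exact h1 i (Finset.mem_insert_of_mem hi)
          · rcases eq_or_ne i a with rfl | hia
            · simpa using hx
            · rw [Function.update_of_ne hia]
              exact h2 i (by simp [hia, hi])
        | zero => exact hf.update_zero r a
        | add x y _ _ hx hy => rw [hf, hx, hy, add_zero]
        | neg x _ hx => rw [hf.update_neg, hx, neg_zero]
      simpa using h3 (r a) (h1 a (Finset.mem_insert_self _ _))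
  exact key Finset.univ r (fun i _ => hr i) (fun i hi => absurd (Finset.mem_univ i) hi)

/-- If a multiadditive function vanishes as soon as one argument lies in `T`, then it depends only
on the arguments modulo `T`. -/
lemma eq_of_sub_mem (hf : IsMultiadditive f) (T : AddSubgroup C)
    (hT : ∀ r i, r i ∈ T → f r = 0) (r r' : Fin n → C) (h : ∀ i, r i - r' i ∈ T) :
    f r = f r' := by
  -- The arguments `r'` are exchanged for `r` one slot at a time.
  have key : ∀ s : Finset (Fin n), f (fun i => if i ∈ s then r i else r' i) = f r' := by
    intro s
    induction s using Finset.induction_on with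
    | empty => simp
    | insert a s ha ih =>
      rw [← ih]
      set q : Fin n → C := fun i => if i ∈ s then r i else r' i with hq
      have h1 : (fun i => if i ∈ insert a s then r i else r' i) = Function.update q a (r a) := by
        funext i
        rcases eq_or_ne i a with rfl | hia <;> simp [*]
      have h2 : q = Function.update q a (r' a) := by
        funext i
        rcases eq_or_ne i a with rfl | hia <;> simp [*]
      rw [h1]
      conv_rhs => rw [h2]
      rw [← sub_eq_zero, ← hf.update_sub]
      exact hT _ a (by simpa using h a)
  simpa using key Finset.univ

/-- Operations on tuples that are additive in each variable. -/
lemma comp {m : ℕ} (hf : IsMultiadditive f) {t : (Fin m → C) → Fin n → C}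
    (ht : ∀ r i, ∃ (i' : Fin n) (θ : C →+ C), ∀ x,
      t (Function.update r i x) = Function.update (t r) i' (θ x)) :
    IsMultiadditive fun r => f (t r) := fun r i x y => by
  obtain ⟨i', θ, h⟩ := ht r i
  simp only [h, map_add, hf (t r) i']

end IsMultiadditive

end Multiadditive

/-- The cancellation in the square of an alternating sum of cofaces. -/
lemma alternating_double_sum {M : Type v} [AddCommGroup M] (n : ℕ) (a : ℕ → ℕ → M)
    (h : ∀ i j, i ≤ j → j ≤ n → a (j + 1) i = a i j) :
    ∑ x ∈ Finset.range (n + 2), ∑ y ∈ Finset.range (n + 1),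
      (-1 : ℤ) ^ x • (-1 : ℤ) ^ y • a x y = 0 := by
  rw [← Finset.sum_product']
  -- The cosimplicial identity pairs `(x, y)`, `y < x`, with `(y, x - 1)`, whose total index has the
  -- opposite parity.
  refine Finset.sum_involution
    (fun z _ => if z.2 < z.1 then (z.2, z.1 - 1) else (z.2 + 1, z.1)) ?_ ?_ ?_ ?_
  · rintro ⟨x, y⟩ hz
    simp only [Finset.mem_product, Finset.mem_range] at hz
    dsimp only
    split_ifs with hyx
    · obtain ⟨j, rfl⟩ : ∃ j, x = j + 1 := ⟨x - 1, by omega⟩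
      simp only [Nat.add_sub_cancel]
      rw [h y j (by omega) (by omega), smul_comm, pow_succ]
      simp
    · rw [h x y (by omega) (by omega)]
      dsimp only
      rw [smul_comm ((-1 : ℤ) ^ (y + 1)), pow_succ]
      simp
  · rintro ⟨x, y⟩ hz _ h'
    dsimp only at h'
    split_ifs at h' with hyx
    · simp only [Prod.mk.injEq] at h'; omega
    · simp only [Prod.mk.injEq] at h'; omega
  · rintro ⟨x, y⟩ hz
    simp only [Finset.mem_product, Finset.mem_range] at hz ⊢
    split_ifs <;> dsimp only <;> omega
  · rintro ⟨x, y⟩ hz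
    by_cases h : y < x
    · simp only [h, if_true, show ¬ x - 1 < y by omega, if_false, Prod.mk.injEq, and_true]
      omega
    · simp [h, show x < y + 1 by omega]

/-! ### Koszul signs and operators acting on one tensor factor -/

namespace ChainAlgebra

variable {K : Type} [CommRing K] (P : ChainAlgebra.{u} K)

@[elab_as_elim]
lemma homogeneous_induction {motive : P.carrier → Prop} (x : P.carrier) (zero : motive 0)
    (hom : ∀ n, ∀ x ∈ P.gr n, motive x) (add : ∀ x y, motive x → motive y → motive (x + y)) :
    motive x :=
  DirectSum.Decomposition.inductionOn P.gr zero (fun m => hom _ _ m.2) (fun x y => add x y) x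

lemma sign_mem {n : ℕ} {x : P.carrier} (hx : x ∈ P.gr n) : P.sign x ∈ P.gr n := by
  rw [P.sign_of_mem hx]; exact Submodule.smul_mem _ _ hx

lemma sign_sign (x : P.carrier) : P.sign (P.sign x) = x := by
  induction x using P.homogeneous_induction with
  | zero => simp
  | hom n x hx =>
    rw [P.sign_of_mem hx, map_smul, P.sign_of_mem hx, smul_smul, ← mul_pow]; simp
  | add x y hx hy => simp [hx, hy]

lemma sign_mul (x y : P.carrier) : P.sign (x * y) = P.sign x * P.sign y := by
  induction x using P.homogeneous_induction with
  | zero => simp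
  | hom n x hx =>
    induction y using P.homogeneous_induction with
    | zero => simp
    | hom m y hy =>
      rw [P.sign_of_mem hx, P.sign_of_mem hy, P.sign_of_mem (SetLike.mul_mem_graded hx hy),
        smul_mul_smul_comm, pow_add]
    | add y y' hy hy' => simp only [mul_add, map_add, hy, hy']
  | add x x' hx hx' => simp only [add_mul, map_add, hx, hx']

/-- This is what lets a contracting homotopy enter the sign calculus on the same footing as `d`, for
which the same rule is `sign_d`. -/
lemma sign_of_odd (θ : P.carrier →+ P.carrier)
    (h : ∀ n, ∀ x ∈ P.gr n, θ x ∈ P.gr (n + 1)) (x : P.carrier) :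
    P.sign (θ x) = -θ (P.sign x) := by
  induction x using P.homogeneous_induction with
  | zero => simp
  | hom n x hx =>
    rw [P.sign_of_mem hx, P.sign_of_mem (h n x hx), pow_succ]
    rcases neg_one_pow_eq_or K n with h | h <;> simp [h]
  | add x y hx hy => simp only [map_add, hx, hy, neg_add]

lemma sign_d (x : P.carrier) : P.sign (P.d x) = -P.d (P.sign x) := by
  induction x using P.homogeneous_induction with
  | zero => simp
  | hom n x hx =>
    cases n with
    | zero => rw [P.d_zero x hx, P.d_zero _ (P.sign_mem hx)]; simp
    | succ n =>
      rw [P.sign_of_mem hx, P.sign_of_mem (P.d_succ n x hx), pow_succ]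
      simp
  | add x y hx hy => simp only [map_add, hx, hy, neg_add]

lemma d_mul (x y : P.carrier) : P.d (x * y) = P.d x * y + P.sign x * P.d y := by
  induction x using P.homogeneous_induction with
  | zero => simp
  | hom n x hx => rw [P.leibniz n x hx, P.sign_of_mem hx, smul_mul_assoc]
  | add x x' hx hx' => simp only [add_mul, map_add, hx, hx']; abel

/-- The operation `r ↦ (σ r₀, …, σ rᵢ₋₁, θ rᵢ, rᵢ₊₁, …)` on tuples. -/
def slotMap {n : ℕ} (θ : P.carrier → P.carrier) (i : Fin n) (r : Fin n → P.carrier) :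
    Fin n → P.carrier :=
  fun j => if j < i then P.sign (r j) else if j = i then θ (r j) else r j

variable {P}

lemma slotMap_update {n : ℕ} (θ : P.carrier →+ P.carrier) (i : Fin n) (r : Fin n → P.carrier)
    (k : Fin n) : ∃ (i' : Fin n) (η : P.carrier →+ P.carrier), ∀ x,
      P.slotMap θ i (Function.update r k x) = Function.update (P.slotMap θ i r) i' (η x) := by
  refine ⟨k, if k < i then P.sign.toAddMonoidHom else if k = i then θ else AddMonoidHom.id _,
    fun x => ?_⟩
  funext j
  rcases eq_or_ne j k with rfl | hjk
  · simp only [slotMap, Function.update_self]; split_ifs <;> rfl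
  · simp only [slotMap, Function.update_of_ne hjk]

/-- The signs on the slots before `i` are applied twice and cancel. -/
lemma slotMap_slotMap_self {n : ℕ} (θ η : P.carrier → P.carrier) (i : Fin n)
    (r : Fin n → P.carrier) :
    P.slotMap θ i (P.slotMap η i r) = Function.update r i (θ (η (r i))) := by
  funext j
  rcases lt_trichotomy j i with h | rfl | h
  · simp [slotMap, h, h.ne, sign_sign]
  · simp [slotMap]
  · simp [slotMap, h.ne', not_lt_of_gt h]

/-- Odd operators in different slots anticommute. For `i < j` the two orders differ only in slot
`i`, which holds `θ (σ rᵢ)` on one side and `σ (θ rᵢ)` on the other. -/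
lemma slotMap_slotMap_of_ne {M : Type v} [AddCommGroup M] {n : ℕ} {f : (Fin n → P.carrier) → M}
    (hf : IsMultiadditive f) {θ η : P.carrier → P.carrier}
    (hθ : ∀ x, P.sign (θ x) = -θ (P.sign x)) (hη : ∀ x, P.sign (η x) = -η (P.sign x))
    {i j : Fin n} (hij : i ≠ j) (r : Fin n → P.carrier) :
    f (P.slotMap θ i (P.slotMap η j r)) = -f (P.slotMap η j (P.slotMap θ i r)) := by
  have key : ∀ {θ η : P.carrier → P.carrier}, (∀ x, P.sign (θ x) = -θ (P.sign x)) →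
      ∀ {i j : Fin n}, i < j →
      f (P.slotMap θ i (P.slotMap η j r)) = -f (P.slotMap η j (P.slotMap θ i r)) := by
    intro θ η hθ i j hij
    set B := P.slotMap η j (P.slotMap θ i r) with hB
    have h1 : P.slotMap θ i (P.slotMap η j r) = Function.update B i (-(B i)) := by
      funext k
      rcases lt_trichotomy k i with h | rfl | h
      · simp [hB, slotMap, h, h.ne, h.trans hij]
      · simp [hB, slotMap, hij, hθ]
      · simp [hB, slotMap, h.ne', not_lt_of_gt h]
    rw [h1, hf.update_neg, Function.update_eq_self]
  rcases lt_or_gt_of_ne hij with h | h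
  · exact key hθ h
  · rw [key hη h, neg_neg]

end ChainAlgebra

/-- Each variable ends up in exactly one slot, either unchanged or multiplied by its neighbour; this
is the form in which `IsMultiadditive.comp` applies to the inner cofaces. -/
lemma contractNth_update {C : Type u} [Ring C] {n : ℕ} (i : Fin n) (r : Fin (n + 1) → C)
    (k : Fin (n + 1)) : ∃ (i' : Fin n) (θ : C →+ C), ∀ x,
      Fin.contractNth i.castSucc (· * ·) (Function.update r k x) =
        Function.update (Fin.contractNth i.castSucc (· * ·) r) i' (θ x) := by
  rcases lt_trichotomy k.val i.val with h | h | h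
  · refine ⟨⟨k, h.trans i.2⟩, AddMonoidHom.id C, fun x => ?_⟩
    funext a
    simp only [Fin.contractNth, Function.update_apply, Fin.ext_iff, Fin.val_castSucc, Fin.val_succ,
      AddMonoidHom.id_apply]
    split_ifs <;> first | rfl | omega
  · refine ⟨i, AddMonoidHom.mulRight (r i.succ), fun x => ?_⟩
    funext a
    simp only [Fin.contractNth, Function.update_apply, Fin.ext_iff, Fin.val_castSucc, Fin.val_succ,
      AddMonoidHom.mulRight_apply]
    split_ifs <;> first | rfl | omega | (congr; omega)
  · rcases Nat.lt_or_ge i.val.succ k.val with h' | h'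
    · refine ⟨⟨k - 1, by omega⟩, AddMonoidHom.id C, fun x => ?_⟩
      funext a
      simp only [Fin.contractNth, Function.update_apply, Fin.ext_iff, Fin.val_castSucc,
        Fin.val_succ, AddMonoidHom.id_apply]
      split_ifs <;> first | rfl | omega
    · refine ⟨i, AddMonoidHom.mulLeft (r i.castSucc), fun x => ?_⟩
      funext a
      simp only [Fin.contractNth, Function.update_apply, Fin.ext_iff, Fin.val_castSucc,
        Fin.val_succ, AddMonoidHom.coe_mulLeft]
      split_ifs <;> first | rfl | omega | (congr; omega)

/-! ### The bicomplex: internal and Hochschild differentials -/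

namespace ChainAlgebraOver

open ChainAlgebra

variable {K : Type} [CommRing K] {A : Type u} [Ring A] [Algebra K A]
  {P : ChainAlgebraOver K A} {M : Type v} [AddCommGroup M] [Module A M] [Module Aᵐᵒᵖ M]

lemma ε_sign (x : P.carrier) : P.ε (P.sign x) = P.ε x := by
  induction x using P.homogeneous_induction with
  | zero => simp
  | hom n x hx =>
    rw [P.sign_of_mem hx]
    cases n with
    | zero => simp
    | succ n => rw [map_smul, P.ε_pos n x hx, smul_zero]
  | add x y hx hy => simp only [map_add, hx, hy]

lemma internal_eq {n : ℕ} (f : (Fin n → P.carrier) → M) (r : Fin n → P.carrier) :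
    P.internal f r = ∑ i, f (P.slotMap P.d i r) := rfl

section Multiadditive

variable {n : ℕ} {f : (Fin n → P.carrier) → M}

lemma _root_.IsMultiadditive.comp_slotMap (hf : IsMultiadditive f) (θ : P.carrier →+ P.carrier)
    (i : Fin n) : IsMultiadditive fun r => f (P.slotMap θ i r) :=
  hf.comp fun r k => slotMap_update θ i r k

lemma _root_.IsMultiadditive.internal (hf : IsMultiadditive f) :
    IsMultiadditive (P.internal f) :=
  IsMultiadditive.sum _ fun i _ => hf.comp_slotMap P.d.toAddMonoidHom i

lemma _root_.IsMultiadditive.hochschild (hf : IsMultiadditive f) :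
    IsMultiadditive (P.hochschild f) := by
  refine (IsMultiadditive.add (IsMultiadditive.add ?_ ?_) ?_)
  · intro r i x y
    cases i using Fin.cases with
    | zero => simp only [Fin.tail_update_zero, Function.update_self, map_add, add_smul]
    | succ i =>
      simp only [Fin.tail_update_succ, hf (Fin.tail r) i, smul_add,
        Function.update_of_ne (Fin.succ_ne_zero i).symm]
  · exact IsMultiadditive.sum _ fun i _ =>
      (hf.comp fun r k => contractNth_update i r k).zsmul _
  · refine IsMultiadditive.zsmul (f := fun r : Fin (n + 1) → P.carrier =>
      op (P.ε (r (Fin.last n))) • f (Fin.init r)) ?_ _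
    intro r i x y
    cases i using Fin.lastCases with
    | last => simp only [Fin.init_update_last, Function.update_self, map_add, op_add, add_smul]
    | cast i =>
      simp only [Fin.init_update_castSucc, hf (Fin.init r) i, smul_add,
        Function.update_of_ne (Fin.castSucc_lt_last i).ne']

lemma internal_add (f g : (Fin n → P.carrier) → M) :
    P.internal (f + g) = P.internal f + P.internal g := by
  funext r; simp [internal_eq, Finset.sum_add_distrib]

lemma internal_neg (f : (Fin n → P.carrier) → M) : P.internal (-f) = -P.internal f := by
  funext r; simp [internal_eq]

lemma internal_zsmul (k : ℤ) (f : (Fin n → P.carrier) → M) :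
    P.internal (k • f) = k • P.internal f := by
  funext r; simp [internal_eq, Finset.smul_sum]

lemma internal_sub (f g : (Fin n → P.carrier) → M) :
    P.internal (f - g) = P.internal f - P.internal g := by
  rw [sub_eq_add_neg, internal_add, internal_neg, sub_eq_add_neg]

/-- The terms with `d` in slots `i ≠ j` cancel in pairs by anticommutation, and the diagonal ones
contain `d ∘ d`. -/
lemma internal_internal (hf : IsMultiadditive f) : P.internal (P.internal f) = 0 := by
  funext r
  simp only [internal_eq, Pi.zero_apply]
  rw [← Finset.sum_product']
  refine Finset.sum_involution (fun z _ => (z.2, z.1)) ?_ ?_ ?_ ?_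
  · rintro ⟨i, j⟩ -
    rcases eq_or_ne i j with rfl | h
    · simp only [slotMap_slotMap_self, P.d_d, hf.update_zero, add_zero]
    · simp only [slotMap_slotMap_of_ne hf P.sign_d P.sign_d h, add_neg_cancel]
  · rintro ⟨i, j⟩ - h' h
    simp only [Prod.mk.injEq] at h
    rw [h.1] at h'
    simp [slotMap_slotMap_self, P.d_d, hf.update_zero] at h'
  · simp
  · simp

/-- The homotopy formula in one variable. -/
lemma internal_homotopy (hf : IsMultiadditive f) (h : P.carrier →+ P.carrier)
    (hh : ∀ n, ∀ x ∈ P.gr n, h x ∈ P.gr (n + 1)) (k : Fin n) (r : Fin n → P.carrier) :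
    P.internal (fun r => f (P.slotMap h k r)) r + P.internal f (P.slotMap h k r) =
      f (Function.update r k (h (P.d (r k)) + P.d (h (r k)))) := by
  simp only [internal_eq]
  -- The cross terms with `d` outside slot `k` cancel, because `h` and `d` are both odd.
  rw [← Finset.sum_add_distrib, Finset.sum_eq_single k]
  · rw [slotMap_slotMap_self, slotMap_slotMap_self, hf]
  · intro j _ hj
    rw [slotMap_slotMap_of_ne hf (P.sign_of_odd h hh) P.sign_d hj.symm, neg_add_cancel]
  · simp

lemma contractNth_slotMap_of_lt (i j : Fin n) (hj : j < i) (r : Fin (n + 1) → P.carrier) :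
    Fin.contractNth i.castSucc (· * ·) (P.slotMap P.d j.castSucc r) =
      P.slotMap P.d j (Fin.contractNth i.castSucc (· * ·) r) := by
  funext a
  simp only [slotMap, Fin.contractNth, Fin.ext_iff, Fin.lt_def, Fin.val_castSucc, Fin.val_succ]
  have := Fin.lt_def.1 hj
  split_ifs <;> first | rfl | omega

lemma contractNth_slotMap_of_gt (i j : Fin n) (hj : i < j) (r : Fin (n + 1) → P.carrier) :
    Fin.contractNth i.castSucc (· * ·) (P.slotMap P.d j.succ r) =
      P.slotMap P.d j (Fin.contractNth i.castSucc (· * ·) r) := by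
  funext a
  simp only [slotMap, Fin.contractNth, Fin.ext_iff, Fin.lt_def, Fin.val_castSucc, Fin.val_succ]
  have := Fin.lt_def.1 hj
  split_ifs <;> first | rfl | omega | exact (P.sign_mul _ _).symm

/-- The Leibniz rule for the product formed in slot `i`: the two factors contribute one term each.
-/
lemma contractNth_slotMap_self (hf : IsMultiadditive f) (i : Fin n) (r : Fin (n + 1) → P.carrier) :
    f (Fin.contractNth i.castSucc (· * ·) (P.slotMap P.d i.castSucc r)) +
        f (Fin.contractNth i.castSucc (· * ·) (P.slotMap P.d i.succ r)) =
      f (P.slotMap P.d i (Fin.contractNth i.castSucc (· * ·) r)) := by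
  set B := P.slotMap P.d i (Fin.contractNth i.castSucc (· * ·) r) with hB
  have h1 : Fin.contractNth i.castSucc (· * ·) (P.slotMap P.d i.castSucc r) =
      Function.update B i (P.d (r i.castSucc) * r i.succ) := by
    funext a
    simp only [hB, slotMap, Fin.contractNth, Function.update_apply, Fin.ext_iff, Fin.lt_def,
      Fin.val_castSucc, Fin.val_succ]
    split_ifs <;> first | rfl | omega | (congr <;> (apply Fin.ext; simpa))
  have h2 : Fin.contractNth i.castSucc (· * ·) (P.slotMap P.d i.succ r) =
      Function.update B i (P.sign (r i.castSucc) * P.d (r i.succ)) := by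
    funext a
    simp only [hB, slotMap, Fin.contractNth, Function.update_apply, Fin.ext_iff, Fin.lt_def,
      Fin.val_castSucc, Fin.val_succ]
    split_ifs <;> first | rfl | omega | (congr <;> (apply Fin.ext; simpa))
  have h3 : B i = P.d (r i.castSucc * r i.succ) := by
    simp [hB, slotMap, Fin.contractNth]
  rw [h1, h2, ← hf, ← P.d_mul, ← h3, Function.update_eq_self]

/-- The operators commute coface by coface. An outer coface sees its end argument only through `ε`,
which kills boundaries and ignores `σ`; an inner coface is compatible with `d` by the Leibniz rule.
The sign that makes the total differential square to zero is in `differential`. -/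
lemma internal_hochschild (hf : IsMultiadditive f) :
    P.internal (P.hochschild f) = P.hochschild (P.internal f) := by
  funext r
  rw [internal_eq]
  simp only [hochschild]
  rw [Finset.sum_add_distrib, Finset.sum_add_distrib]
  congr 2
  · rw [Fin.sum_univ_succ, internal_eq, Finset.smul_sum]
    have h0 : P.slotMap P.d 0 r 0 = P.d (r 0) := by simp [slotMap]
    rw [h0, P.ε_d, zero_smul, zero_add]
    refine Finset.sum_congr rfl fun j _ => ?_
    have h1 : P.slotMap P.d j.succ r 0 = P.sign (r 0) := by simp [slotMap]
    have h2 : Fin.tail (P.slotMap P.d j.succ r) = P.slotMap P.d j (Fin.tail r) := by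
      funext a; simp [slotMap, Fin.tail]
    rw [h1, h2, ε_sign]
  · rw [Finset.sum_comm]
    refine Finset.sum_congr rfl fun i _ => ?_
    rw [← Finset.smul_sum, internal_eq]
    congr 1
    -- Of the `n + 1` slots, `i.castSucc` and `i.succ` merge into slot `i`; the remaining ones
    -- correspond to the slots `j ≠ i`.
    rw [Fin.sum_univ_succAbove _ i.castSucc,
      ← Finset.add_sum_erase Finset.univ _ (Finset.mem_univ i),
      ← Finset.add_sum_erase Finset.univ (fun j => f (P.slotMap P.d j _)) (Finset.mem_univ i),
      ← add_assoc]
    congr 1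
    · rw [Fin.succAbove_of_le_castSucc _ _ le_rfl, contractNth_slotMap_self hf]
    · refine Finset.sum_congr rfl fun j hj => ?_
      rcases lt_or_gt_of_ne (Finset.ne_of_mem_erase hj) with h | h
      · rw [Fin.succAbove_of_castSucc_lt _ _ (by simpa using h), contractNth_slotMap_of_lt i j h]
      · rw [Fin.succAbove_of_le_castSucc _ _ (by simpa using h.le),
          contractNth_slotMap_of_gt i j h]
  · rw [Fin.sum_univ_castSucc, internal_eq, Finset.smul_sum, Finset.smul_sum]
    have h0 : P.slotMap P.d (Fin.last n) r (Fin.last n) = P.d (r (Fin.last n)) := by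
      simp [slotMap]
    rw [h0, P.ε_d, op_zero, zero_smul, smul_zero, add_zero]
    refine Finset.sum_congr rfl fun j _ => ?_
    have h1 : P.slotMap P.d j.castSucc r (Fin.last n) = r (Fin.last n) := by
      simp [slotMap, (Fin.castSucc_lt_last j).ne', (Fin.castSucc_lt_last j).le]
    have h2 : Fin.init (P.slotMap P.d j.castSucc r) = P.slotMap P.d j (Fin.init r) := by
      funext a; simp [slotMap, Fin.init]
    rw [h1, h2]

end Multiadditive

/-- The summands of the Hochschild coboundary. -/
def coface {n : ℕ} (k : ℕ) (f : (Fin n → P.carrier) → M) (r : Fin (n + 1) → P.carrier) : M :=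
  if k = 0 then P.ε (r 0) • f (Fin.tail r)
  else if k ≤ n then f fun a : Fin n =>
    if a.val + 1 < k then r a.castSucc else if a.val + 1 = k then r a.castSucc * r a.succ
      else r a.succ
  else op (P.ε (r (Fin.last n))) • f (Fin.init r)

lemma hochschild_eq_sum {n : ℕ} (f : (Fin n → P.carrier) → M) (r : Fin (n + 1) → P.carrier) :
    P.hochschild f r = ∑ k ∈ Finset.range (n + 2), (-1 : ℤ) ^ k • coface k f r := by
  rw [Finset.sum_range_succ, Finset.sum_range_succ', hochschild, Finset.sum_range,
    add_comm (∑ _, _)]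
  congr 2
  · simp [coface]
  · refine Finset.sum_congr rfl fun i _ => ?_
    rw [coface, if_neg (by omega), if_pos (by omega)]
    congr 2
    funext a
    simp only [Fin.contractNth, Fin.val_castSucc, add_lt_add_iff_right, add_left_inj]
  · simp [coface]

/-- The cosimplicial identity. The commutation of the left and right actions enters only for the two
outer cofaces, `i = 0` and `j = n + 1`. -/
lemma coface_coface [SMulCommClass A Aᵐᵒᵖ M] {n : ℕ} (f : (Fin n → P.carrier) → M) (i j : ℕ)
    (hij : i ≤ j) (hj : j ≤ n + 1) (r : Fin (n + 2) → P.carrier) :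
    coface (j + 1) (coface i f) r = coface i (coface j f) r := by
  rcases Nat.eq_zero_or_pos i with rfl | hi
  · rcases Nat.eq_zero_or_pos j with rfl | hj0
    · simp only [coface, if_pos, show (1 : ℕ) ≤ n + 1 by omega, one_ne_zero, if_false,
        zero_add]
      rw [smul_smul]
      congr 1
      simp [Fin.tail]
    · rcases Nat.lt_or_ge n j with h | h
      · obtain rfl : j = n + 1 := by omega
        simp only [coface, if_true, show ¬ n + 1 + 1 = 0 by omega, if_false,
          show ¬ n + 1 + 1 ≤ n + 1 by omega, show ¬ n + 1 = 0 by omega,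
          show ¬ n + 1 ≤ n by omega]
        exact (smul_comm _ _ _).symm
      · simp only [coface, if_true, show ¬ j + 1 = 0 by omega, if_false,
          show j + 1 ≤ n + 1 by omega, show ¬ j = 0 by omega, h]
        congr 1
        · simp [hj0]
        · congr 1
          funext a
          simp [Fin.tail]
  · rcases Nat.lt_or_ge n i with h' | h'
    · obtain rfl : i = n + 1 := by omega
      obtain rfl : j = n + 1 := by omega
      simp only [coface, show ¬ n + 1 + 1 = 0 by omega, if_false,
        show ¬ n + 1 + 1 ≤ n + 1 by omega, show ¬ n + 1 = 0 by omega,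
        show ¬ n + 1 ≤ n by omega, le_refl, if_true]
      rw [smul_smul, ← op_mul]
      congr 1
      · simp [Fin.init]
      · congr 1
        funext a
        have := a.2
        simp only [Fin.init, Fin.val_castSucc]
        split_ifs <;> first | rfl | omega
    · rcases Nat.lt_or_ge n j with h | h
      · obtain rfl : j = n + 1 := by omega
        simp only [coface, show ¬ n + 1 + 1 = 0 by omega, if_false, hi.ne', h',
          show ¬ n + 1 + 1 ≤ n + 1 by omega, show ¬ n + 1 = 0 by omega,
          show ¬ n + 1 ≤ n by omega, if_true, show i ≤ n + 1 by omega]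
        congr 1
        simp only [Fin.val_last]
        split_ifs <;> first | rfl | omega
      · simp only [coface, show ¬ j + 1 = 0 by omega, if_false, hi.ne', h',
          show j + 1 ≤ n + 1 by omega, show ¬ j = 0 by omega,
          h, if_true, show i ≤ n + 1 by omega]
        congr 1
        funext a
        simp only [Fin.val_castSucc, Fin.val_succ, Fin.succ_castSucc]
        split_ifs <;> first | rfl | omega | simp [mul_assoc]

lemma hochschild_hochschild [SMulCommClass A Aᵐᵒᵖ M] {n : ℕ} (f : (Fin n → P.carrier) → M) :
    P.hochschild (P.hochschild f) = 0 := by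
  funext r
  have h : ∀ x, coface x (P.hochschild f) r =
      ∑ y ∈ Finset.range (n + 2), (-1 : ℤ) ^ y • coface x (coface y f) r := by
    intro x
    rw [coface]
    split_ifs with h1 h2
    · rw [hochschild_eq_sum, Finset.smul_sum]
      refine Finset.sum_congr rfl fun y _ => ?_
      rw [smul_comm]
      conv_rhs => rw [coface]
      rw [if_pos h1]
    · rw [hochschild_eq_sum]
      simp [coface, h1, h2]
    · rw [hochschild_eq_sum, Finset.smul_sum]
      simp only [smul_comm _ ((-1 : ℤ) ^ _)]
      refine Finset.sum_congr rfl fun y _ => ?_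
      conv_rhs => rw [coface]
      rw [if_neg h1, if_neg h2]
  rw [hochschild_eq_sum]
  simp only [h, Finset.smul_sum]
  exact alternating_double_sum (n + 1) _ fun i j hij hj => coface_coface f i j hij hj r

end ChainAlgebraOver

/-! ### Degrees of cochains -/

namespace ChainAlgebraOver

open ChainAlgebra

variable {K : Type} [CommRing K] {A : Type u} [Ring A] [Algebra K A]
  {P : ChainAlgebraOver K A} {M : Type v} [AddCommGroup M] [Module A M] [Module Aᵐᵒᵖ M]

section Functions

variable {n : ℕ} {f g : (Fin n → P.carrier) → M}

/-- `f` vanishes on `x₁ ⊗ ⋯ ⊗ xₙ` unless `|x₁| + ⋯ + |xₙ| + n = m`. -/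
def HasDegree (f : (Fin n → P.carrier) → M) (m : ℕ) : Prop :=
  ∀ (r : Fin n → P.carrier) (e : Fin n → ℕ), (∀ i, r i ∈ P.gr (e i)) → ∑ i, e i + n ≠ m → f r = 0

lemma HasDegree.add {m : ℕ} (hf : HasDegree f m) (hg : HasDegree g m) : HasDegree (f + g) m :=
  fun r e hr he => by rw [Pi.add_apply, hf r e hr he, hg r e hr he, add_zero]

lemma HasDegree.sub {m : ℕ} (hf : HasDegree f m) (hg : HasDegree g m) : HasDegree (f - g) m :=
  fun r e hr he => by rw [Pi.sub_apply, hf r e hr he, hg r e hr he, sub_zero]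

lemma HasDegree.zsmul {m : ℕ} (hf : HasDegree f m) (k : ℤ) : HasDegree (k • f) m :=
  fun r e hr he => by rw [Pi.smul_apply, hf r e hr he, smul_zero]

lemma sum_add_single (e : Fin n → ℕ) (i : Fin n) :
    ∑ j, (e + Pi.single i 1 : Fin n → ℕ) j = ∑ j, e j + 1 := by
  simp [Finset.sum_add_distrib]

lemma HasDegree.internal {m : ℕ} (ha : IsMultiadditive f) (hf : HasDegree f m) :
    HasDegree (P.internal f) (m + 1) := by
  intro r e hr he
  rw [internal_eq]
  refine Finset.sum_eq_zero fun i _ => ?_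
  rcases hi : e i with _ | k
  · have h0 : P.slotMap P.d i r i = 0 := by
      simp only [slotMap, lt_irrefl, if_false, if_true]
      exact P.d_zero _ (hi ▸ hr i)
    rw [← Function.update_eq_self i (P.slotMap P.d i r), h0, ha.update_zero]
  · have h1 : e = Function.update e i k + Pi.single i 1 := by
      funext j
      rcases eq_or_ne j i with rfl | h <;> simp [*]
    refine hf _ (Function.update e i k) (fun j => ?_) ?_
    · rcases lt_trichotomy j i with h | rfl | h
      · simpa [slotMap, h, h.ne] using P.sign_mem (hr j)
      · have := P.d_succ k (r j) (hi ▸ hr j)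
        simpa [slotMap] using this
      · simpa [slotMap, h.ne', not_lt_of_gt h] using hr j
    · rw [h1, sum_add_single] at he
      omega

lemma HasDegree.comp_slotMap {m : ℕ} (hf : HasDegree f (m + 1)) (h : P.carrier →+ P.carrier)
    (hh : ∀ n, ∀ x ∈ P.gr n, h x ∈ P.gr (n + 1)) (i : Fin n) :
    HasDegree (fun r => f (P.slotMap h i r)) m := by
  intro r e hr he
  refine hf _ (e + Pi.single i 1) (fun j => ?_) ?_
  · rcases lt_trichotomy j i with h | rfl | h
    · simpa [slotMap, h, h.ne] using P.sign_mem (hr j)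
    · simpa [slotMap] using hh _ _ (hr j)
    · simpa [slotMap, h.ne', not_lt_of_gt h] using hr j
  · rw [sum_add_single]; omega

lemma sum_contractNth (e : Fin (n + 1) → ℕ) (i : Fin n) :
    ∑ a, Fin.contractNth i.castSucc (· + ·) e a = ∑ a, e a := by
  rw [Fin.sum_univ_succAbove _ i.castSucc, ← Finset.add_sum_erase Finset.univ _ (Finset.mem_univ i),
    ← Finset.add_sum_erase Finset.univ (fun j => e (i.castSucc.succAbove j)) (Finset.mem_univ i),
    ← add_assoc]
  congr 1
  · rw [Fin.succAbove_of_le_castSucc _ _ le_rfl]; simp [Fin.contractNth]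
  · refine Finset.sum_congr rfl fun j hj => ?_
    rcases lt_or_gt_of_ne (Finset.ne_of_mem_erase hj) with h | h
    · rw [Fin.succAbove_of_castSucc_lt _ _ (by simpa using h), Fin.contractNth_apply_of_lt]
      simpa using h
    · rw [Fin.succAbove_of_le_castSucc _ _ (by simpa using h.le), Fin.contractNth_apply_of_gt]
      simpa using h

lemma HasDegree.hochschild {m : ℕ} (hf : HasDegree f m) : HasDegree (P.hochschild f) (m + 1) := by
  intro r e hr he
  have h1 : P.ε (r 0) • f (Fin.tail r) = 0 := by
    rcases h : e 0 with _ | k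
    · rw [hf (Fin.tail r) (Fin.tail e) (fun i => hr i.succ), smul_zero]
      rw [Fin.sum_univ_succ, h] at he
      change ∑ i : Fin n, e i.succ + n ≠ m
      omega
    · rw [P.ε_pos k _ (h ▸ hr 0), zero_smul]
  have h2 : op (P.ε (r (Fin.last n))) • f (Fin.init r) = 0 := by
    rcases h : e (Fin.last n) with _ | k
    · rw [hf (Fin.init r) (Fin.init e) (fun i => hr i.castSucc), smul_zero]
      rw [Fin.sum_univ_castSucc, h] at he
      change ∑ i : Fin n, e i.castSucc + n ≠ m
      omega
    · rw [P.ε_pos k _ (h ▸ hr (Fin.last n)), op_zero, zero_smul]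
  rw [ChainAlgebraOver.hochschild, h1, h2, smul_zero, zero_add, add_zero]
  refine Finset.sum_eq_zero fun i _ => ?_
  rw [hf _ (Fin.contractNth i.castSucc (· + ·) e), smul_zero]
  · intro a
    simp only [Fin.contractNth]
    split_ifs
    · exact hr _
    · exact SetLike.mul_mem_graded (hr _) (hr _)
    · exact hr _
  · rw [sum_contractNth]; omega

lemma hochschild_add (f g : (Fin n → P.carrier) → M) :
    P.hochschild (f + g) = P.hochschild f + P.hochschild g := by
  funext r
  simp only [hochschild_eq_sum, Pi.add_apply, ← Finset.sum_add_distrib, ← smul_add]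
  refine Finset.sum_congr rfl fun k _ => ?_
  congr 1
  simp only [coface]
  split_ifs <;> simp

lemma hochschild_zsmul (k : ℤ) (f : (Fin n → P.carrier) → M) :
    P.hochschild (k • f) = k • P.hochschild f := by
  funext r
  simp only [hochschild_eq_sum, Pi.smul_apply, Finset.smul_sum]
  refine Finset.sum_congr rfl fun j _ => ?_
  rw [smul_comm k]
  congr 1
  simp only [coface]
  split_ifs
  · rw [Pi.smul_apply, smul_comm]
  · rfl
  · rw [Pi.smul_apply, smul_comm]

lemma hochschild_zero : P.hochschild (0 : (Fin n → P.carrier) → M) = 0 := by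
  simpa using hochschild_zsmul (P := P) 0 (0 : (Fin n → P.carrier) → M)

lemma closure_homogeneous : AddSubgroup.closure {x | ∃ n, x ∈ P.gr n} = ⊤ := by
  rw [eq_top_iff]
  rintro x -
  induction x using P.homogeneous_induction with
  | zero => exact zero_mem _
  | hom n x hx => exact AddSubgroup.subset_closure ⟨n, hx⟩
  | add x y hx hy => exact add_mem hx hy

lemma _root_.IsMultiadditive.eq_zero_of_homogeneous (hf : IsMultiadditive f)
    (h : ∀ r (e : Fin n → ℕ), (∀ i, r i ∈ P.gr (e i)) → f r = 0) : f = 0 := by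
  funext r
  refine hf.eq_zero_of_closure (fun _ => {x | ∃ n, x ∈ P.gr n}) (fun r hr => ?_) r fun i => ?_
  · choose e he using hr
    exact h r e he
  · rw [closure_homogeneous]; trivial

end Functions

/-! ### Differential ideals and functions that vanish on them -/

/-- Homogeneous two-sided ideals that are closed under the differential and vanish in `A`. -/
structure IsDGIdeal (P : ChainAlgebraOver K A) (T : AddSubgroup P.carrier) : Prop where
  mul_left : ∀ a x, x ∈ T → a * x ∈ T
  mul_right : ∀ a x, x ∈ T → x * a ∈ T
  d_mem : ∀ x ∈ T, P.d x ∈ T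
  ε_eq_zero : ∀ x ∈ T, P.ε x = 0
  proj_mem : ∀ n, ∀ x ∈ T, GradedRing.proj P.gr n x ∈ T

lemma proj_mem_gr (n : ℕ) (x : P.carrier) : GradedRing.proj P.gr n x ∈ P.gr n :=
  (DirectSum.decompose P.gr x n).2

lemma proj_of_mem {n : ℕ} {x : P.carrier} (hx : x ∈ P.gr n) : GradedRing.proj P.gr n x = x :=
  DirectSum.decompose_of_mem_same P.gr hx

lemma proj_of_mem_ne {n m : ℕ} {x : P.carrier} (hx : x ∈ P.gr n) (h : n ≠ m) :
    GradedRing.proj P.gr m x = 0 :=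
  DirectSum.decompose_of_mem_ne P.gr hx h

lemma exists_sum_proj (x : P.carrier) : ∃ s : Finset ℕ, ∑ n ∈ s, GradedRing.proj P.gr n x = x := by
  classical
  exact ⟨_, DirectSum.sum_support_decompose P.gr x⟩

lemma IsDGIdeal.sign_mem {T : AddSubgroup P.carrier} (hT : IsDGIdeal P T) (x : P.carrier)
    (hx : x ∈ T) : P.sign x ∈ T := by
  obtain ⟨s, hs⟩ := exists_sum_proj x
  rw [← hs, map_sum]
  refine sum_mem fun n _ => ?_
  rw [P.sign_of_mem (proj_mem_gr n x)]
  rcases neg_one_pow_eq_or K n with h | h <;> rw [h]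
  · rw [one_smul]; exact hT.proj_mem n x hx
  · rw [neg_smul, one_smul]; exact neg_mem (hT.proj_mem n x hx)

/-- Families of functions that vanish if one of the arguments lies in `T`. -/
def VanishesOn (T : AddSubgroup P.carrier) {n : ℕ} (f : (Fin n → P.carrier) → M) : Prop :=
  ∀ r i, r i ∈ T → f r = 0

section Vanishing

variable {T : AddSubgroup P.carrier} {n : ℕ} {f g : (Fin n → P.carrier) → M}

lemma VanishesOn.add (hf : VanishesOn T f) (hg : VanishesOn T g) : VanishesOn T (f + g) :=
  fun r i h => by rw [Pi.add_apply, hf r i h, hg r i h, add_zero]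

lemma VanishesOn.sub (hf : VanishesOn T f) (hg : VanishesOn T g) : VanishesOn T (f - g) :=
  fun r i h => by rw [Pi.sub_apply, hf r i h, hg r i h, sub_zero]

lemma VanishesOn.zsmul (hf : VanishesOn T f) (k : ℤ) : VanishesOn T (k • f) :=
  fun r i h => by rw [Pi.smul_apply, hf r i h, smul_zero]

lemma VanishesOn.internal (hT : IsDGIdeal P T) (hf : VanishesOn T f) :
    VanishesOn T (P.internal f) := by
  intro r i h
  rw [internal_eq]
  refine Finset.sum_eq_zero fun j _ => hf _ i ?_
  simp only [slotMap]
  split_ifs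
  · exact hT.sign_mem _ h
  · exact hT.d_mem _ h
  · exact h

lemma VanishesOn.hochschild (hT : IsDGIdeal P T) (hf : VanishesOn T f) :
    VanishesOn T (P.hochschild f) := by
  intro r i h
  have h1 : P.ε (r 0) • f (Fin.tail r) = 0 := by
    cases i using Fin.cases with
    | zero => rw [hT.ε_eq_zero _ h, zero_smul]
    | succ i => rw [hf (Fin.tail r) i h, smul_zero]
  have h2 : op (P.ε (r (Fin.last n))) • f (Fin.init r) = 0 := by
    cases i using Fin.lastCases with
    | last => rw [hT.ε_eq_zero _ h, op_zero, zero_smul]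
    | cast i => rw [hf (Fin.init r) i h, smul_zero]
  rw [ChainAlgebraOver.hochschild, h1, h2, smul_zero, zero_add, add_zero]
  refine Finset.sum_eq_zero fun k _ => ?_
  have : ∃ a, Fin.contractNth k.castSucc (· * ·) r a ∈ T := by
    rcases lt_trichotomy i.val k.val with h' | h' | h'
    · refine ⟨⟨i, by omega⟩, ?_⟩
      rw [Fin.contractNth_apply_of_lt _ _ _ _ (by simpa using h')]
      exact h
    · refine ⟨k, ?_⟩
      rw [Fin.contractNth_apply_of_eq _ _ _ _ (by simp)]
      obtain rfl : i = k.castSucc := Fin.ext h'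
      exact hT.mul_right _ _ h
    · rcases Nat.lt_or_ge (k.val + 1) i.val with h'' | h''
      · refine ⟨⟨i - 1, by omega⟩, ?_⟩
        rw [Fin.contractNth_apply_of_gt _ _ _ _ (by simp only [Fin.val_castSucc]; omega)]
        convert h
        apply Fin.ext
        simp only [Fin.val_succ]
        omega
      · refine ⟨k, ?_⟩
        rw [Fin.contractNth_apply_of_eq _ _ _ _ (by simp)]
        obtain rfl : i = k.succ := Fin.ext (by simp only [Fin.val_succ]; omega)
        exact hT.mul_left _ _ h
  obtain ⟨a, ha⟩ := this
  rw [hf _ a ha, smul_zero]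

/-- Vanishing can be checked on homogeneous arguments. -/
lemma _root_.IsMultiadditive.eq_zero_of_homogeneous_slot (hf : IsMultiadditive f)
    (hT : IsDGIdeal P T) (i : Fin n)
    (h : ∀ r (e : Fin n → ℕ), (∀ i, r i ∈ P.gr (e i)) → r i ∈ T → f r = 0) (r : Fin n → P.carrier)
    (hr : r i ∈ T) : f r = 0 := by
  refine hf.eq_zero_of_closure
    (fun j => if j = i then {x | x ∈ T ∧ ∃ n, x ∈ P.gr n} else {x | ∃ n, x ∈ P.gr n})
    (fun r hr => ?_) r fun j => ?_
  · have h1 : ∀ j, ∃ n, r j ∈ P.gr n := by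
      intro j
      have := hr j
      split_ifs at this
      exacts [this.2, this]
    have h2 : r i ∈ T := by
      have := hr i
      simp only [if_true] at this
      exact this.1
    choose e he using h1
    exact h r e he h2
  · split_ifs with hj
    · subst hj
      obtain ⟨s, hs⟩ := exists_sum_proj (r j)
      rw [← hs]
      exact sum_mem fun n _ =>
        AddSubgroup.subset_closure ⟨hT.proj_mem n _ hr, n, proj_mem_gr n _⟩
    · rw [closure_homogeneous]; trivial

/-- A contraction, modulo `p`, of the ideal `T` in degrees `< N`. -/
structure Contraction (P : ChainAlgebraOver K A) (T : AddSubgroup P.carrier) (p N : ℕ) where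
  h : P.carrier →+ P.carrier
  gr_mem : ∀ n, ∀ x ∈ P.gr n, h x ∈ P.gr (n + 1)
  mem : ∀ x, h x ∈ T
  homotopy : ∀ n < N, ∀ x ∈ P.gr n, x ∈ T → ∃ y, x - (h (P.d x) + P.d (h x)) = p • y

/-- If `∂ f` vanishes on `T`, then `f` vanishes on `T` up to some `∂ g`. -/
lemma exists_sub_internal_vanishesOn (hT : IsDGIdeal P T) {p N : ℕ} (hp : ∀ x : M, p • x = 0)
    (H : Contraction P T p N) {m : ℕ} (hm : m < N) (hf : IsMultiadditive f)
    (hdeg : HasDegree f (m + 1)) (hd : VanishesOn T (P.internal f)) :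
    ∃ g : (Fin n → P.carrier) → M, IsMultiadditive g ∧ HasDegree g m ∧
      VanishesOn T (f - P.internal g) := by
  -- The slots are corrected from left to right; `k` counts those in which vanishing on `T` is
  -- already achieved.
  have key : ∀ k ≤ n, ∃ g : (Fin n → P.carrier) → M, IsMultiadditive g ∧ HasDegree g m ∧
      ∀ r (i : Fin n), i.val < k → r i ∈ T → (f - P.internal g) r = 0 := by
    intro k
    induction k with
    | zero => exact fun _ => ⟨0, IsMultiadditive.zero, fun _ _ _ _ => rfl, by simp⟩
    | succ k ih =>
      intro hk
      obtain ⟨g, hg, hgd, hgv⟩ := ih (by omega)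
      set f' := f - P.internal g with hf'
      have hfa : IsMultiadditive f' := hf.sub hg.internal
      have hfd : HasDegree f' (m + 1) := hdeg.sub (hgd.internal hg)
      have hfi : P.internal f' = P.internal f := by
        rw [hf', internal_sub, internal_internal hg, sub_zero]
      let k' : Fin n := ⟨k, hk⟩
      let g' : (Fin n → P.carrier) → M := fun r => f' (P.slotMap H.h k' r)
      have hga' : IsMultiadditive g' := hfa.comp_slotMap H.h k'
      have hgd' : HasDegree g' m := hfd.comp_slotMap H.h H.gr_mem k'
      have heq : f - P.internal (g + g') = f' - P.internal g' := by
        rw [internal_add, hf', sub_sub]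
      have hval : ∀ r, (f' - P.internal g') r =
          f' (Function.update r k' (r k' - (H.h (P.d (r k')) + P.d (H.h (r k'))))) := by
        intro r
        have h1 := internal_homotopy hfa H.h H.gr_mem k' r
        -- All values of `h` lie in `T`, and `∂f' = ∂f` vanishes on `T`. So in the homotopy formula
        -- only `f'` with `1 - (hd + dh)` applied in slot `k` survives.
        have h2 : P.internal f' (P.slotMap H.h k' r) = 0 := by
          rw [hfi]
          refine hd _ k' ?_
          simp only [slotMap, lt_irrefl, if_false, if_true]
          exact H.mem _
        rw [h2, add_zero] at h1
        rw [hfa.update_sub, ← h1, Function.update_eq_self]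
        rfl
      refine ⟨g + g', hg.add hga', hgd.add hgd', fun r i hi hri => ?_⟩
      rw [heq]
      rcases Nat.lt_succ_iff_lt_or_eq.1 hi with hi | hi
      · rw [hval]
        -- The correction changes only the argument in slot `k`, so vanishing in the earlier slots
        -- persists.
        refine hgv _ i hi ?_
        rw [Function.update_of_ne (Fin.ne_of_lt hi)]
        exact hri
      · obtain rfl : i = k' := Fin.ext hi
        refine (hfa.sub hga'.internal).eq_zero_of_homogeneous_slot hT k' (fun r e he hr => ?_) r hri
        by_cases hs : ∑ i, e i + n = m + 1
        · have h1 : e k' ≤ ∑ i, e i :=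
            Finset.single_le_sum (f := e) (fun _ _ => Nat.zero_le _) (Finset.mem_univ k')
          -- With at least one argument and total degree `m + 1`, each argument has degree at most
          -- `m < N`, so the homotopy is available. It holds only modulo `p`, which suffices because
          -- `p` kills `M`.
          obtain ⟨y, hy⟩ := H.homotopy (e k') (by omega) (r k') (he k') hr
          rw [hval, hy, hfa.update_nsmul, hp]
        · exact (hfd.sub (hgd'.internal hga')) r e he hs
  obtain ⟨g, h1, h2, h3⟩ := key n le_rfl
  exact ⟨g, h1, h2, fun r i => h3 r i i.2⟩

end Vanishing

/-! ### Normalising cochains of the total complex -/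

section Cochains

variable {m : ℕ} {c : P.Family M}

lemma cochains_multiadditive (hc : c ∈ P.cochains M m) (n : ℕ) : IsMultiadditive (c n) := hc.1 n

lemma cochains_hasDegree (hc : c ∈ P.cochains M m) (n : ℕ) : HasDegree (c n) m := hc.2.2 n

/-- Over a quotient ring of ℤ, additivity already gives linearity; this covers both ground rings. -/
lemma mem_cochains (hK : Function.Surjective (Int.cast : ℤ → K))
    (ha : ∀ n, IsMultiadditive (c n)) (hd : ∀ n, HasDegree (c n) m) : c ∈ P.cochains M m := by
  refine ⟨ha, fun n r i k x => ?_, hd⟩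
  obtain ⟨k, rfl⟩ := hK k
  rw [map_intCast, Int.cast_smul_eq_zsmul, Int.cast_smul_eq_zsmul, (ha n).update_zsmul]

/-- Every argument contributes at least 1 to the total degree. Hence inductions over the number of
arguments stop. -/
lemma cochains_eq_zero (hc : c ∈ P.cochains M m) {n : ℕ} (hn : m < n) : c n = 0 :=
  (cochains_multiadditive hc n).eq_zero_of_homogeneous fun r e hr =>
    cochains_hasDegree hc n r e hr (by omega)

lemma differential_zero (c : P.Family M) : P.differential M c 0 = 0 := rfl

lemma differential_succ (c : P.Family M) (n : ℕ) : P.differential M c (n + 1) =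
    P.hochschild (c n) + (-1 : ℤ) ^ (n + 1) • P.internal (c (n + 1)) := rfl

lemma differential_mem (hK : Function.Surjective (Int.cast : ℤ → K))
    (hc : c ∈ P.cochains M m) : P.differential M c ∈ P.cochains M (m + 1) := by
  refine mem_cochains hK (fun n => ?_) (fun n => ?_) <;> cases n with
  | zero => rw [differential_zero]; first | exact IsMultiadditive.zero | exact fun _ _ _ _ => rfl
  | succ n =>
    rw [differential_succ]
    have h1 := cochains_multiadditive hc n
    have h2 := cochains_multiadditive hc (n + 1)
    first
    | exact h1.hochschild.add (h2.internal.zsmul _)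
    | exact (cochains_hasDegree hc n).hochschild.add
        (((cochains_hasDegree hc (n + 1)).internal h2).zsmul _)

/-- The two mixed terms cancel since the sign of the internal part alternates with the number of
arguments. -/
lemma differential_differential [SMulCommClass A Aᵐᵒᵖ M] (hc : ∀ n, IsMultiadditive (c n)) :
    P.differential M (P.differential M c) = 0 := by
  funext n
  match n with
  | 0 => rfl
  | 1 =>
    rw [differential_succ, differential_zero, hochschild_zero, differential_succ, internal_add,
      internal_hochschild (hc 0), internal_zsmul, internal_internal (hc _),
      show P.internal (c 0) = 0 from funext fun r => by simp [internal_eq], hochschild_zero]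
    simp
  | n + 2 =>
    rw [differential_succ, differential_succ, differential_succ, internal_add, hochschild_add,
      hochschild_hochschild, hochschild_zsmul, internal_zsmul, internal_internal (hc _),
      internal_hochschild (hc _), pow_succ _ (n + 1)]
    simp

variable {T : AddSubgroup P.carrier}

lemma vanishesOn_differential (hT : IsDGIdeal P T) (hc : ∀ n, VanishesOn T (c n)) (n : ℕ) :
    VanishesOn T (P.differential M c n) := by
  cases n with
  | zero => exact fun _ _ _ => rfl
  | succ n =>
    rw [differential_succ]
    exact ((hc n).hochschild hT).add (((hc _).internal hT).zsmul _)

/-- A cochain whose coboundary vanishes on `T` can be changed by a coboundary so that it vanishes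
on `T`, in degrees in which `T` is contractible. -/
theorem exists_sub_differential_vanishesOn [SMulCommClass A Aᵐᵒᵖ M]
    (hK : Function.Surjective (Int.cast : ℤ → K)) (hT : IsDGIdeal P T) {p N : ℕ}
    (hp : ∀ x : M, p • x = 0) (H : Contraction P T p N) (hm : m < N)
    (hc : c ∈ P.cochains M (m + 1)) (hd : ∀ n, VanishesOn T (P.differential M c n)) :
    ∃ b ∈ P.cochains M m, ∀ n, VanishesOn T ((c - P.differential M b) n) := by
  -- Induction on the number of arguments, i.e. along the filtration of the bicomplex by columns.
  have key : ∀ k, ∃ b ∈ P.cochains M m, ∀ n < k, VanishesOn T ((c - P.differential M b) n) := by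
    intro k
    induction k with
    | zero => exact ⟨0, zero_mem _, by simp⟩
    | succ k ih =>
      obtain ⟨b, hb, hbv⟩ := ih
      rcases k with _ | k
      · refine ⟨b, hb, fun n hn r i => ?_⟩
        obtain rfl : n = 0 := by omega
        exact i.elim0
      set c' := c - P.differential M b with hc'
      have hcm : c' ∈ P.cochains M (m + 1) := sub_mem hc (differential_mem hK hb)
      have hdc : P.differential M c' = P.differential M c := by
        rw [hc', map_sub, differential_differential (cochains_multiadditive hb), sub_zero]
      -- Component `k + 1` of the coboundary is the Hochschild coboundary of `c' k` plus, up to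
      -- sign, the internal one of `c' (k + 1)`; the total and the first summand vanish on `T`.
      have hi : VanishesOn T (P.internal (c' (k + 1))) := by
        have h1 := hd (k + 1)
        rw [← hdc, differential_succ] at h1
        have h2 := (h1.sub ((hbv k (by omega)).hochschild hT)).zsmul ((-1 : ℤ) ^ (k + 1))
        rwa [add_sub_cancel_left, smul_smul, ← mul_pow, neg_mul_neg, one_mul, one_pow,
          one_smul] at h2
      obtain ⟨g, hga, hgd, hgv⟩ := exists_sub_internal_vanishesOn hT hp H hm
        (cochains_multiadditive hcm (k + 1)) (cochains_hasDegree hcm (k + 1)) hi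
      -- The sign compensates the one in `differential`. The coboundary of `b'` lives in components
      -- `k + 1` and `k + 2`, so the components already treated do not change.
      let b' : P.Family M := Pi.single (k + 1) ((-1 : ℤ) ^ (k + 1) • g)
      have hb' : b' ∈ P.cochains M m := by
        refine mem_cochains hK (fun n => ?_) (fun n => ?_) <;>
        · rcases eq_or_ne n (k + 1) with rfl | hn
          · simp only [b', Pi.single_eq_same]
            first | exact hga.zsmul _ | exact hgd.zsmul _
          · simp only [b', Pi.single_eq_of_ne hn]
            first | exact IsMultiadditive.zero | exact fun _ _ _ _ => rfl
      refine ⟨b + b', add_mem hb hb', fun n hn => ?_⟩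
      have heq : (c - P.differential M (b + b')) n = c' n - P.differential M b' n := by
        rw [map_add, hc']; simp only [Pi.sub_apply, Pi.add_apply, sub_sub]
      rw [heq]
      rcases Nat.lt_succ_iff_lt_or_eq.1 hn with hn | rfl
      · have h0 : P.differential M b' n = 0 := by
          cases n with
          | zero => rfl
          | succ n =>
            rw [differential_succ]
            simp only [b']
            rw [Pi.single_eq_of_ne (by omega), Pi.single_eq_of_ne (by omega), hochschild_zero]
            funext r
            simp [internal_eq]
        rw [h0, sub_zero]
        exact hbv n hn
      · rw [differential_succ]
        simp only [b']
        rw [Pi.single_eq_same, Pi.single_eq_of_ne (by omega), hochschild_zero, zero_add,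
          internal_zsmul, smul_smul, ← mul_pow, neg_mul_neg, one_mul, one_pow, one_smul]
        exact hgv
  obtain ⟨b, hb, hbv⟩ := key (m + 2)
  refine ⟨b, hb, fun n => ?_⟩
  rcases Nat.lt_or_ge n (m + 2) with h | h
  · exact hbv n h
  · have h0 : (c - P.differential M b) n = 0 :=
      cochains_eq_zero (sub_mem hc (differential_mem hK hb)) (by omega)
    rw [h0]
    exact fun _ _ _ => rfl

/-- Cochains of degree `0` have no arguments. -/
lemma vanishesOn_of_mem_cochains_zero (hc : c ∈ P.cochains M 0) (n : ℕ) : VanishesOn T (c n) := by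
  cases n with
  | zero => exact fun _ i => i.elim0
  | succ n => rw [cochains_eq_zero hc n.succ_pos]; exact fun _ _ _ => rfl

end Cochains

end ChainAlgebraOver

/-! ### Construction of contractions modulo `p` -/

/-- Contractions of acyclic complexes of vector spaces. -/
lemma exists_contraction_of_exact {F : Type*} {V : Type*} [Field F] [AddCommGroup V] [Module F V]
    (d : V →ₗ[F] V) (J : ℕ → Submodule F V) (N : ℕ) (hdJ : ∀ n, ∀ x ∈ J (n + 1), d x ∈ J n)
    (hdd : ∀ x, d (d x) = 0)
    (hex : ∀ n < N, ∀ x ∈ J n, d x = 0 → ∃ y ∈ J (n + 1), d y = x) :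
    ∃ h : ℕ → V →ₗ[F] V, (∀ n x, h n x ∈ J (n + 1)) ∧
      (0 < N → ∀ x ∈ J 0, d x = 0 → d (h 0 x) = x) ∧
      ∀ n, n + 1 < N → ∀ x ∈ J (n + 1), d (h (n + 1) x) + h n (d x) = x := by
  let Z : ℕ → Submodule F V := fun n => J n ⊓ LinearMap.ker d
  have hpr : ∀ n, ∃ pr : V →ₗ[F] V, (∀ x, pr x ∈ Z n) ∧ ∀ x ∈ Z n, pr x = x := by
    intro n
    obtain ⟨g, hg⟩ := (Z n).subtype.exists_leftInverse_of_injective (Z n).ker_subtype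
    refine ⟨(Z n).subtype ∘ₗ g, fun x => (g x).2, fun x hx => ?_⟩
    have := LinearMap.congr_fun hg ⟨x, hx⟩
    exact congrArg Subtype.val this
  choose pr hpr1 hpr2 using hpr
  have hk : ∀ n, ∃ k : V →ₗ[F] V, (∀ x, k x ∈ J (n + 1)) ∧ (n < N → ∀ x, d (k x) = pr n x) := by
    intro n
    by_cases hn : n < N
    · let g : J (n + 1) →ₗ[F] V := d ∘ₗ (J (n + 1)).subtype
      have hle : ∀ x, pr n x ∈ LinearMap.range g := by
        intro x
        obtain ⟨y, hy, hyx⟩ := hex n hn (pr n x) (hpr1 n x).1 (hpr1 n x).2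
        exact ⟨⟨y, hy⟩, hyx⟩
      obtain ⟨s, hs⟩ := g.rangeRestrict.exists_rightInverse_of_surjective
        (LinearMap.range_eq_top.2 g.surjective_rangeRestrict)
      refine ⟨(J (n + 1)).subtype ∘ₗ s ∘ₗ (pr n).codRestrict _ hle, fun x => (s _).2,
        fun _ x => ?_⟩
      have := LinearMap.congr_fun hs ((pr n).codRestrict _ hle x)
      exact congrArg Subtype.val this
    · exact ⟨0, fun x => zero_mem _, fun h => absurd h hn⟩
  choose k hk1 hk2 using hk
  have hd : ∀ n < N, ∀ x, d (k n x - pr (n + 1) (k n x)) = pr n x := by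
    intro n hn x
    rw [map_sub, hk2 n hn, show d (pr (n + 1) (k n x)) = 0 from (hpr1 (n + 1) _).2, sub_zero]
  -- Here `pr n` projects onto the cycles and `k n` lifts `pr n` through `d`. Removing the cycle
  -- part of `k n` makes `h n (d x) = x - pr (n + 1) x`, while `d (h (n + 1) x) = pr (n + 1) x`.
  refine ⟨fun n => k n - pr (n + 1) ∘ₗ k n, fun n x => sub_mem (hk1 n x) (hpr1 _ _).1,
    fun h0 x hx hdx => (hd 0 h0 x).trans (hpr2 0 x ⟨hx, hdx⟩), fun n hn x hx => ?_⟩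
  have h1 : d (k n (d x)) = d x := by
    rw [hk2 n (by omega), hpr2 n _ ⟨hdJ n x hx, hdd x⟩]
  have h2 : pr (n + 1) (k n (d x) - x) = k n (d x) - x :=
    hpr2 _ _ ⟨sub_mem (hk1 n _) hx, by
      change d _ = 0
      rw [map_sub, h1, sub_self]⟩
  change d (k (n + 1) x - pr (n + 2) (k (n + 1) x)) + (k n (d x) - pr (n + 1) (k n (d x))) = x
  rw [hd (n + 1) hn, ← sub_eq_zero]
  rw [map_sub] at h2
  rw [sub_eq_iff_eq_add] at h2
  rw [h2]
  abel

namespace ChainAlgebraOver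

open ChainAlgebra

variable {K : Type} [CommRing K] {A : Type u} [Ring A] [Algebra K A] {P : ChainAlgebraOver K A}

lemma proj_d (n : ℕ) (x : P.carrier) :
    GradedRing.proj P.gr n (P.d x) = P.d (GradedRing.proj P.gr (n + 1) x) := by
  induction x using P.homogeneous_induction with
  | zero => simp
  | hom k x hx =>
    rcases k with _ | k
    · rw [P.d_zero x hx, proj_of_mem_ne hx (by omega), map_zero, map_zero]
    · rcases eq_or_ne k n with rfl | h
      · rw [proj_of_mem (P.d_succ k x hx), proj_of_mem hx]
      · rw [proj_of_mem_ne (P.d_succ k x hx) h, proj_of_mem_ne hx (by omega), map_zero]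
  | add x y hx hy => simp only [map_add, hx, hy]

lemma proj_mem_of_mem {T : AddSubgroup P.carrier} {n m : ℕ} {x : P.carrier} (hx : x ∈ P.gr n)
    (hT : x ∈ T) : GradedRing.proj P.gr m x ∈ T := by
  rcases eq_or_ne n m with rfl | h
  · rwa [proj_of_mem hx]
  · rw [proj_of_mem_ne hx h]; exact zero_mem _

/-- The additive map with prescribed restrictions to the homogeneous components. -/
def ofComponents (φ : ℕ → P.carrier →+ P.carrier) : P.carrier →+ P.carrier :=
  (DirectSum.toAddMonoid fun n => (φ n).comp (P.gr n).toAddSubmonoid.subtype).comp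
    (DirectSum.decomposeAddEquiv P.gr).toAddMonoidHom

lemma ofComponents_of_mem (φ : ℕ → P.carrier →+ P.carrier) {n : ℕ} {x : P.carrier}
    (hx : x ∈ P.gr n) : ofComponents φ x = φ n x := by
  change DirectSum.toAddMonoid _ (DirectSum.decompose P.gr x) = _
  rw [DirectSum.decompose_of_mem P.gr hx]
  exact DirectSum.toAddMonoid_of _ _ _

/-- The complex `P / p P` of vector spaces. -/
lemma exists_reduction (P : ChainAlgebraOver K A) (p : ℕ) :
    ∃ (V : Type u) (_ : AddCommGroup V) (_ : Module K V) (_ : Module (ZMod p) V)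
      (mk : P.carrier →ₗ[K] V) (d : V →+ V), Function.Surjective mk ∧
      (∀ x, mk x = 0 ↔ ∃ z, x = p • z) ∧ ∀ x, d (mk x) = mk (P.d x) := by
  let B : Submodule K P.carrier := LinearMap.range (LinearMap.lsmul K P.carrier (p : K))
  have hB : ∀ x, x ∈ B ↔ ∃ z, x = p • z := by
    intro x
    constructor
    · rintro ⟨z, rfl⟩; exact ⟨z, by simp [Nat.cast_smul_eq_nsmul]⟩
    · rintro ⟨z, rfl⟩; exact ⟨z, by simp [Nat.cast_smul_eq_nsmul]⟩
  have hpV : ∀ v : P.carrier ⧸ B, p • v = 0 := by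
    intro v
    obtain ⟨x, rfl⟩ := B.mkQ_surjective v
    rw [← map_nsmul, Submodule.mkQ_apply, Submodule.Quotient.mk_eq_zero, hB]
    exact ⟨x, rfl⟩
  have hdB : B ≤ B.comap P.d := by
    intro x hx
    obtain ⟨z, rfl⟩ := (hB x).1 hx
    exact (hB _).2 ⟨P.d z, map_nsmul _ _ _⟩
  exact ⟨P.carrier ⧸ B, inferInstance, inferInstance, AddCommGroup.zmodModule hpV, B.mkQ,
    (B.mapQ B P.d hdB).toAddMonoidHom, B.mkQ_surjective,
    fun x => (Submodule.Quotient.mk_eq_zero B).trans (hB x), fun x => rfl⟩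

/-- An ideal that is acyclic modulo `p` is contractible modulo `p`. -/
theorem exists_contraction [Module.Projective K P.carrier]
    (hK : Function.Surjective (Int.cast : ℤ → K)) {T : AddSubgroup P.carrier}
    (hT : IsDGIdeal P T) {p : ℕ} [Fact p.Prime] (hpT : ∀ z : P.carrier, p • z ∈ T) {N : ℕ}
    (hex : ∀ n < N, ∀ x ∈ P.gr n, x ∈ T → (∃ z, P.d x = p • z) →
      ∃ y ∈ P.gr (n + 1), y ∈ T ∧ ∃ z, P.d y = x + p • z) :
    Nonempty (Contraction P T p N) := by
  obtain ⟨V, _, _, _, mk, d', hsurj, hker, hd'⟩ := exists_reduction P p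
  have hmk : ∀ x y, mk x = mk y → ∃ z, x = y + p • z := by
    intro x y h
    rw [← sub_eq_zero, ← map_sub, hker] at h
    obtain ⟨z, hz⟩ := h
    exact ⟨z, by rw [← hz]; abel⟩
  have hpV : ∀ v : V, p • v = 0 := by
    intro v
    obtain ⟨x, rfl⟩ := hsurj v
    rw [← map_nsmul, hker]
    exact ⟨x, rfl⟩
  let d : V →ₗ[ZMod p] V := d'.toZModLinearMap p
  have hdmk : ∀ x, d (mk x) = mk (P.d x) := hd'
  let J : ℕ → Submodule (ZMod p) V := fun n =>
    AddSubgroup.toZModSubmodule p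
      ((T ⊓ (P.gr n).toAddSubgroup).map mk.toAddMonoidHom)
  have hJ : ∀ n v, v ∈ J n ↔ ∃ x, x ∈ T ∧ x ∈ P.gr n ∧ mk x = v := by
    intro n v
    constructor
    · rintro ⟨x, ⟨h1, h2⟩, h3⟩; exact ⟨x, h1, h2, h3⟩
    · rintro ⟨x, h1, h2, h3⟩; exact ⟨x, ⟨h1, h2⟩, h3⟩
  obtain ⟨h, hhJ, hh0, hhs⟩ := exists_contraction_of_exact d J N
    (by
      intro n v hv
      obtain ⟨x, h1, h2, rfl⟩ := (hJ _ _).1 hv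
      exact (hJ _ _).2 ⟨P.d x, hT.d_mem x h1, P.d_succ n x h2, (hdmk x).symm⟩)
    (by
      intro v
      obtain ⟨x, rfl⟩ := hsurj v
      rw [hdmk, hdmk, P.d_d, map_zero])
    (by
      intro n hn v hv hdv
      obtain ⟨x, h1, h2, rfl⟩ := (hJ _ _).1 hv
      rw [hdmk, ← map_zero mk] at hdv
      obtain ⟨z, hz⟩ := hmk _ _ hdv
      obtain ⟨y, hy1, hy2, w, hw⟩ := hex n hn x h2 h1 ⟨z, by rw [hz, zero_add]⟩
      refine ⟨mk y, (hJ _ _).2 ⟨y, hy2, hy1, rfl⟩, ?_⟩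
      rw [hdmk, hw, map_add, map_nsmul, hpV, add_zero])
  -- The contraction of the image of `T` in `P/p` lifts to `P` because `P` is projective; the
  -- homotopy identity survives only modulo `p`.
  have hlift : ∀ n, ∃ h' : P.carrier →ₗ[K] P.carrier, ∀ x, mk (h' x) = h n (mk x) := by
    intro n
    let g : P.carrier →ₗ[K] V :=
      { toFun := fun x => h n (mk x)
        map_add' := fun x y => by simp only [map_add]
        map_smul' := fun k x => by
          obtain ⟨k, rfl⟩ := hK k
          simp only [Int.cast_smul_eq_zsmul, map_zsmul, RingHom.id_apply] }
    obtain ⟨h', hh'⟩ := Module.projective_lifting_property mk g hsurj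
    exact ⟨h', fun x => LinearMap.congr_fun hh' x⟩
  choose h' hh' using hlift
  -- The lift need not be homogeneous, so its component of degree `n + 1` is taken.
  let H : P.carrier →+ P.carrier := ofComponents fun n =>
    (GradedRing.proj P.gr (n + 1)).comp (h' n).toAddMonoidHom
  have hH : ∀ n, ∀ x ∈ P.gr n, H x = GradedRing.proj P.gr (n + 1) (h' n x) :=
    fun n x hx => ofComponents_of_mem _ hx
  refine ⟨⟨H, fun n x hx => ?_, fun x => ?_, fun n hn x hx hxT => ?_⟩⟩
  · rw [hH n x hx]; exact proj_mem_gr _ _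
  · induction x using P.homogeneous_induction with
    | zero => rw [map_zero]; exact zero_mem _
    | hom n x hx =>
      rw [hH n x hx]
      -- The lift agrees modulo `pP ⊆ T` with an element of `T`, and `T` is homogeneous.
      have h1 := hhJ n (mk x)
      rw [← hh', hJ] at h1
      obtain ⟨t, ht, -, htx⟩ := h1
      obtain ⟨z, hz⟩ := hmk _ _ htx.symm
      rw [hz]
      exact hT.proj_mem _ _ (add_mem ht (hpT z))
    | add x y hx hy => rw [map_add]; exact add_mem hx hy
  · have hxJ : mk x ∈ J n := (hJ _ _).2 ⟨x, hxT, hx, rfl⟩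
    rcases n with _ | n
    · have h1 := hh0 hn _ hxJ (by rw [hdmk, P.d_zero x hx, map_zero])
      rw [← hh', hdmk] at h1
      obtain ⟨z, hz⟩ := hmk _ _ h1
      refine ⟨-GradedRing.proj P.gr 0 z, ?_⟩
      rw [P.d_zero x hx, map_zero, zero_add, hH 0 x hx, ← proj_d, hz, map_add, proj_of_mem hx,
        map_nsmul, smul_neg]
      abel
    · have h1 := hhs n hn _ hxJ
      rw [← hh', hdmk, hdmk, ← hh', ← map_add] at h1
      obtain ⟨z, hz⟩ := hmk _ _ h1
      refine ⟨-GradedRing.proj P.gr (n + 1) z, ?_⟩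
      rw [hH _ x hx, hH n _ (P.d_succ n x hx), ← proj_d, ← map_add, add_comm (h' n _), hz, map_add,
        proj_of_mem hx, map_nsmul, smul_neg]
      abel

/-! ### The truncation ideal -/

/-- The ideal `p P + d P₂ + P_{≥ 2}`. -/
def truncationIdeal (P : ChainAlgebraOver K A) (p : ℕ) : AddSubgroup P.carrier :=
  AddSubgroup.closure {x | (∃ y, x = p • y) ∨ (∃ w ∈ P.gr 2, x = P.d w) ∨ ∃ n, x ∈ P.gr (n + 2)}

section TruncationIdeal

variable {p : ℕ}

lemma nsmul_mem_truncationIdeal (y : P.carrier) : p • y ∈ P.truncationIdeal p :=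
  AddSubgroup.subset_closure (Or.inl ⟨y, rfl⟩)

lemma d_mem_truncationIdeal {w : P.carrier} (hw : w ∈ P.gr 2) : P.d w ∈ P.truncationIdeal p :=
  AddSubgroup.subset_closure (Or.inr (Or.inl ⟨w, hw, rfl⟩))

lemma mem_truncationIdeal_of_mem {n : ℕ} {x : P.carrier} (hx : x ∈ P.gr (n + 2)) :
    x ∈ P.truncationIdeal p :=
  AddSubgroup.subset_closure (Or.inr (Or.inr ⟨n, hx⟩))

/-- Additive maps that send the generators of the ideal to `S`. -/
lemma truncationIdeal_induction {C : Type*} [AddCommGroup C] (φ : P.carrier →+ C)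
    (S : AddSubgroup C) (h1 : ∀ y, φ (p • y) ∈ S) (h2 : ∀ w ∈ P.gr 2, φ (P.d w) ∈ S)
    (h3 : ∀ n, ∀ x ∈ P.gr (n + 2), φ x ∈ S) {x : P.carrier} (hx : x ∈ P.truncationIdeal p) :
    φ x ∈ S := by
  have : P.truncationIdeal p ≤ S.comap φ := by
    refine (AddSubgroup.closure_le _).2 ?_
    rintro x (⟨y, rfl⟩ | ⟨w, hw, rfl⟩ | ⟨n, hn⟩)
    exacts [h1 y, h2 w hw, h3 n x hn]
  exact this hx

/-- Only products with `d w`, `w` of degree 2, need thought: a factor of degree 0 can be moved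
inside `d`, and a factor of positive degree lifts the product to degree ≥ 2. -/
lemma isDGIdeal_truncationIdeal (hp : (p : A) = 0) : IsDGIdeal P (P.truncationIdeal p) where
  mul_left a x hx := by
    induction a using P.homogeneous_induction with
    | zero => rw [zero_mul]; exact zero_mem _
    | hom k a ha =>
      refine truncationIdeal_induction (AddMonoidHom.mulLeft a) _ (fun y => ?_) (fun w hw => ?_)
        (fun n x hx => ?_) hx
      · rw [map_nsmul]; exact nsmul_mem_truncationIdeal _
      · rcases k with _ | k
        · have h1 : a * P.d w = P.d (a * w) := by
            rw [P.d_mul, P.d_zero a ha, P.sign_of_mem ha]; simp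
          rw [AddMonoidHom.coe_mulLeft, h1]
          refine d_mem_truncationIdeal ?_
          have := SetLike.mul_mem_graded ha hw
          rwa [zero_add] at this
        · refine mem_truncationIdeal_of_mem (n := k) ?_
          have := SetLike.mul_mem_graded ha (P.d_succ 1 w hw)
          rwa [show k + 1 + 1 = k + 2 by omega] at this
      · refine mem_truncationIdeal_of_mem (n := k + n) ?_
        have := SetLike.mul_mem_graded ha hx
        rwa [show k + (n + 2) = k + n + 2 by omega] at this
    | add a b ha hb => rw [add_mul]; exact add_mem ha hb
  mul_right a x hx := by
    induction a using P.homogeneous_induction with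
    | zero => rw [mul_zero]; exact zero_mem _
    | hom k a ha =>
      refine truncationIdeal_induction (AddMonoidHom.mulRight a) _ (fun y => ?_) (fun w hw => ?_)
        (fun n x hx => ?_) hx
      · rw [map_nsmul]; exact nsmul_mem_truncationIdeal _
      · rcases k with _ | k
        · have h1 : P.d w * a = P.d (w * a) := by
            rw [P.d_mul, P.d_zero a ha]; simp
          rw [AddMonoidHom.mulRight_apply, h1]
          refine d_mem_truncationIdeal ?_
          have := SetLike.mul_mem_graded hw ha
          rwa [add_zero] at this
        · refine mem_truncationIdeal_of_mem (n := k) ?_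
          have := SetLike.mul_mem_graded (P.d_succ 1 w hw) ha
          rwa [show 1 + (k + 1) = k + 2 by omega] at this
      · refine mem_truncationIdeal_of_mem (n := n + k) ?_
        have := SetLike.mul_mem_graded hx ha
        rwa [show n + 2 + k = n + k + 2 by omega] at this
    | add a b ha hb => rw [mul_add]; exact add_mem ha hb
  d_mem x hx := by
    refine truncationIdeal_induction P.d.toAddMonoidHom _ (fun y => ?_) (fun w hw => ?_)
      (fun n x hx => ?_) hx
    · rw [map_nsmul]; exact nsmul_mem_truncationIdeal _
    · rw [LinearMap.toAddMonoidHom_coe, P.d_d]; exact zero_mem _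
    · rcases n with _ | n
      · exact d_mem_truncationIdeal hx
      · exact mem_truncationIdeal_of_mem (P.d_succ _ x hx)
  ε_eq_zero x hx := by
    refine truncationIdeal_induction P.ε.toRingHom.toAddMonoidHom ⊥ (fun y => ?_) (fun w hw => ?_)
      (fun n x hx => ?_) hx
    · rw [map_nsmul, nsmul_eq_mul, hp, zero_mul]; exact zero_mem _
    · exact P.ε_d w
    · exact P.ε_pos _ x hx
  proj_mem n x hx := by
    refine truncationIdeal_induction (GradedRing.proj P.gr n) _ (fun y => ?_) (fun w hw => ?_)
      (fun n x hx => ?_) hx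
    · rw [map_nsmul]; exact nsmul_mem_truncationIdeal _
    · exact proj_mem_of_mem (P.d_succ 1 w hw) (d_mem_truncationIdeal hw)
    · exact proj_mem_of_mem hx (mem_truncationIdeal_of_mem hx)

lemma exists_of_mem_truncationIdeal_zero {x : P.carrier} (hx : x ∈ P.gr 0)
    (hT : x ∈ P.truncationIdeal p) : ∃ y ∈ P.gr 0, x = p • y := by
  have h := truncationIdeal_induction (GradedRing.proj P.gr 0)
    ((P.gr 0).toAddSubgroup.map (nsmulAddMonoidHom p)) (fun y => ?_) (fun w hw => ?_)
    (fun n x hx => ?_) hT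
  · rw [proj_of_mem hx] at h
    obtain ⟨y, hy, rfl⟩ := h
    exact ⟨y, hy, rfl⟩
  · rw [map_nsmul]; exact ⟨_, proj_mem_gr 0 y, rfl⟩
  · rw [proj_of_mem_ne (P.d_succ 1 w hw) one_ne_zero]; exact zero_mem _
  · rw [proj_of_mem_ne hx (by omega)]; exact zero_mem _

lemma exists_of_mem_truncationIdeal_one {x : P.carrier} (hx : x ∈ P.gr 1)
    (hT : x ∈ P.truncationIdeal p) : ∃ y ∈ P.gr 1, ∃ w ∈ P.gr 2, x = p • y + P.d w := by
  have h := truncationIdeal_induction (GradedRing.proj P.gr 1)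
    ((P.gr 1).toAddSubgroup.map (nsmulAddMonoidHom p) ⊔
      (P.gr 2).toAddSubgroup.map P.d.toAddMonoidHom) (fun y => ?_) (fun w hw => ?_)
    (fun n x hx => ?_) hT
  · rw [proj_of_mem hx] at h
    obtain ⟨_, ⟨y, hy, rfl⟩, _, ⟨w, hw, rfl⟩, rfl⟩ := AddSubgroup.mem_sup.1 h
    exact ⟨y, hy, w, hw, rfl⟩
  · rw [map_nsmul]; exact AddSubgroup.mem_sup_left ⟨_, proj_mem_gr 1 y, rfl⟩
  · rw [proj_of_mem (P.d_succ 1 w hw)]; exact AddSubgroup.mem_sup_right ⟨w, hw, rfl⟩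
  · rw [proj_of_mem_ne hx (by omega)]; exact zero_mem _

/-- The contraction of the truncation ideal in degrees `0` and `1`. -/
lemma exists_contraction_two [Module.Projective K P.carrier]
    (hK : Function.Surjective (Int.cast : ℤ → K)) [Fact p.Prime] (hp : (p : A) = 0) :
    Nonempty (Contraction P (P.truncationIdeal p) p 2) := by
  refine exists_contraction hK (isDGIdeal_truncationIdeal hp) nsmul_mem_truncationIdeal
    fun n hn x hx hT _ => ?_
  match n, hn with
  | 0, _ =>
    obtain ⟨y, -, rfl⟩ := exists_of_mem_truncationIdeal_zero hx hT
    exact ⟨0, zero_mem _, zero_mem _, -y, by simp⟩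
  | 1, _ =>
    obtain ⟨y, -, w, hw, rfl⟩ := exists_of_mem_truncationIdeal_one hx hT
    -- In degrees 0 and 1 every element of the ideal is a boundary from the ideal modulo `p`,
    -- whatever the ground ring.
    exact ⟨w, hw, mem_truncationIdeal_of_mem (n := 0) hw, -y, by simp⟩

/-- The contraction of the truncation ideal in all degrees, if there is no `p`-torsion. -/
lemma exists_contraction_of_torsionFree [Module.Projective K P.carrier]
    (hK : Function.Surjective (Int.cast : ℤ → K)) [Fact p.Prime] (hp : (p : A) = 0)
    (hP : P.IsWeakEquivalence) (htf : ∀ x : P.carrier, p • x = 0 → x = 0) (N : ℕ) :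
    Nonempty (Contraction P (P.truncationIdeal p) p N) := by
  refine exists_contraction hK (isDGIdeal_truncationIdeal hp) nsmul_mem_truncationIdeal
    fun n hn x hx hT hz => ?_
  match n with
  | 0 =>
    obtain ⟨y, -, rfl⟩ := exists_of_mem_truncationIdeal_zero hx hT
    exact ⟨0, zero_mem _, zero_mem _, -y, by simp⟩
  | 1 =>
    obtain ⟨y, -, w, hw, rfl⟩ := exists_of_mem_truncationIdeal_one hx hT
    exact ⟨w, hw, mem_truncationIdeal_of_mem (n := 0) hw, -y, by simp⟩
  | n + 2 =>
    obtain ⟨z, hz⟩ := hz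
    set y := GradedRing.proj P.gr (n + 1) z with hy
    have h1 : P.d x = p • y := by
      rw [hy, ← map_nsmul, ← hz, proj_of_mem (P.d_succ _ x hx)]
    -- Here torsion-freeness enters: `p • d y = d (d x) = 0`. So `y` is a cycle of positive degree,
    -- hence `y = d t`, and the cycle `x - p • t` is a boundary.
    have h2 : P.d y = 0 := htf _ (by rw [← map_nsmul, ← h1, P.d_d])
    obtain ⟨t, ht, hty⟩ := hP.exact n y (proj_mem_gr _ _) h2
    obtain ⟨w, hw, hwx⟩ := hP.exact (n + 1) (x - p • t) (sub_mem hx (nsmul_mem ht p))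
      (by rw [map_sub, map_nsmul, hty, h1, sub_self])
    refine ⟨w, hw, mem_truncationIdeal_of_mem (n := n + 1) hw, -t, ?_⟩
    rw [hwx, smul_neg, sub_eq_add_neg]

end TruncationIdeal

end ChainAlgebraOver

/-! ### Kernel and image of reduction modulo `n` for free rings -/

namespace FreeGraded

lemma basisFreeMonoid_apply (K : Type) [CommRing K] (X : Type u) (w : FreeMonoid X) :
    FreeAlgebra.basisFreeMonoid K X w = FreeMonoid.lift (FreeAlgebra.ι K) w := by
  have h : FreeAlgebra.basisFreeMonoid K X w =
      FreeAlgebra.equivMonoidAlgebraFreeMonoid.symm (MonoidAlgebra.single w 1) := by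
    simp only [FreeAlgebra.basisFreeMonoid, Module.Basis.map_apply, Finsupp.coe_basisSingleOne]
    rfl
  rw [h]
  change MonoidAlgebra.lift K _ _ (FreeMonoid.lift (FreeAlgebra.ι K)) _ = _
  rw [MonoidAlgebra.lift_single, one_smul]

/-- The kernel of the reduction modulo `n` of a free ring. -/
lemma exists_eq_nsmul_of_push_eq_zero {n : ℕ} {X : Type u} (x : FreeAlgebra ℤ X)
    (hx : push ℤ (ZMod n) (id : X → X) x = 0) : ∃ y, x = n • y := by
  let B : AddSubgroup (FreeAlgebra ℤ X) := (nsmulAddMonoidHom n).range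
  have hV : ∀ v : FreeAlgebra ℤ X ⧸ B, n • v = 0 := by
    intro v
    obtain ⟨x, rfl⟩ := QuotientAddGroup.mk'_surjective B v
    rw [← map_nsmul, QuotientAddGroup.mk'_apply, QuotientAddGroup.eq_zero_iff]
    exact ⟨x, rfl⟩
  obtain ⟨V, _, _, mk, hmk⟩ : ∃ (V : Type u) (_ : AddCommGroup V) (_ : Module (ZMod n) V)
      (mk : FreeAlgebra ℤ X →+ V), ∀ x, mk x = 0 → ∃ y, x = n • y := by
    refine ⟨_, inferInstance, AddCommGroup.zmodModule hV, QuotientAddGroup.mk' B, fun x hx => ?_⟩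
    rw [QuotientAddGroup.mk'_apply, QuotientAddGroup.eq_zero_iff] at hx
    obtain ⟨y, rfl⟩ := hx
    exact ⟨y, rfl⟩
  -- Sending each word to its class modulo `n` defines `s`; composed with reduction it is the
  -- quotient map, so reduction kills only multiples of `n`.
  let s : FreeAlgebra (ZMod n) X →ₗ[ZMod n] V :=
    (FreeAlgebra.basisFreeMonoid (ZMod n) X).constr (ZMod n)
      fun w => mk (FreeAlgebra.basisFreeMonoid ℤ X w)
  have h : s.toAddMonoidHom.toIntLinearMap ∘ₗ
      (push ℤ (ZMod n) (id : X → X)).toLinearMap = mk.toIntLinearMap := by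
    refine (FreeAlgebra.basisFreeMonoid ℤ X).ext fun w => ?_
    have h1 : push ℤ (ZMod n) (id : X → X) (FreeAlgebra.basisFreeMonoid ℤ X w) =
        FreeAlgebra.basisFreeMonoid (ZMod n) X w := by
      rw [basisFreeMonoid_apply, basisFreeMonoid_apply]
      induction w using FreeMonoid.inductionOn' with
      | one => simp
      | of_mul x w ih => simp only [map_mul, ih, FreeMonoid.lift_eval_of, push_ι, id]
    change s (push ℤ (ZMod n) (id : X → X) _) = mk _
    rw [h1]
    exact (FreeAlgebra.basisFreeMonoid (ZMod n) X).constr_basis _ _ _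
  refine hmk x ?_
  have := LinearMap.congr_fun h x
  refine this.symm.trans ?_
  change s (push ℤ (ZMod n) (id : X → X) x) = 0
  rw [hx, map_zero]

/-- Elements whose generators lift along a degree-preserving map can be lifted. -/
lemma exists_push_eq {K K' : Type} [CommRing K] [CommRing K'] [Algebra K K']
    (hK : Function.Surjective (algebraMap K K')) {G G' : Type u} {deg : G → ℕ} {deg' : G' → ℕ}
    {m : G → G'} (hdeg : ∀ g, deg' (m g) = deg g) {n : ℕ}
    (hm : ∀ g', deg' g' ≤ n → ∃ g, m g = g') {x : FreeAlgebra K' G'}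
    (hx : x ∈ component K' deg' n) : ∃ y ∈ component K deg n, push K K' m y = x := by
  induction hx using Submodule.span_induction with
  | mem x h =>
    obtain ⟨l, hl, rfl⟩ := h
    have h1 : ∀ g' ∈ l, ∃ g, m g = g' := fun g hg =>
      hm g (hl ▸ List.single_le_sum (fun _ _ => Nat.zero_le _) _ (List.mem_map_of_mem hg))
    obtain ⟨l', rfl⟩ : ∃ l' : List G, l'.map m = l := by
      clear hl
      induction l with
      | nil => exact ⟨[], rfl⟩
      | cons g l ih =>
        obtain ⟨l', rfl⟩ := ih fun g hg => h1 g (List.mem_cons_of_mem _ hg)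
        obtain ⟨g', rfl⟩ := h1 g List.mem_cons_self
        exact ⟨g' :: l', rfl⟩
    refine ⟨(l'.map (FreeAlgebra.ι K)).prod, Submodule.subset_span ⟨l', ?_, rfl⟩, ?_⟩
    · refine Eq.trans ?_ hl
      rw [List.map_map]
      congr 1
      exact List.map_congr_left fun g _ => (hdeg g).symm
    · rw [map_list_prod, List.map_map, List.map_map]
      congr 1
      exact List.map_congr_left fun g _ => by simp
  | zero => exact ⟨0, zero_mem _, map_zero _⟩
  | add x y _ _ hx hy =>
    obtain ⟨x', hx', rfl⟩ := hx
    obtain ⟨y', hy', rfl⟩ := hy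
    exact ⟨x' + y', add_mem hx' hy', map_add _ _ _⟩
  | smul k x _ hx =>
    obtain ⟨x', hx', rfl⟩ := hx
    obtain ⟨k, rfl⟩ := hK k
    exact ⟨k • x', Submodule.smul_mem _ _ hx', by rw [map_smul, algebraMap_smul]⟩

end FreeGraded

namespace ChainAlgebraOver

open ChainAlgebra

/-! ### Maps of truncations -/

section TruncationIdealMap

variable {K K' : Type} [CommRing K] [CommRing K'] [Algebra K K']
  {A A' : Type u} [Ring A] [Algebra K A] [Ring A'] [Algebra K' A'] {f : A →+* A'}
  {P : ChainAlgebraOver K A} {P' : ChainAlgebraOver K' A'} {p : ℕ}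

lemma Hom.map_truncationIdeal (u : Hom f P P') {x : P.carrier} (hx : x ∈ P.truncationIdeal p) :
    u.toRingHom x ∈ P'.truncationIdeal p := by
  refine truncationIdeal_induction u.toRingHom.toAddMonoidHom _ (fun y => ?_) (fun w hw => ?_)
    (fun n x hx => ?_) hx
  · rw [map_nsmul]; exact nsmul_mem_truncationIdeal _
  · have h := d_mem_truncationIdeal (p := p) (u.map_gr 2 w hw)
    rwa [← u.map_d] at h
  · exact mem_truncationIdeal_of_mem (u.map_gr _ x hx)

lemma Hom.map_proj (u : Hom f P P') (n : ℕ) (x : P.carrier) :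
    u.toRingHom (GradedRing.proj P.gr n x) = GradedRing.proj P'.gr n (u.toRingHom x) := by
  induction x using P.homogeneous_induction with
  | zero => simp
  | hom k x hx =>
    rcases eq_or_ne k n with rfl | h
    · rw [proj_of_mem hx, proj_of_mem (u.map_gr _ x hx)]
    · rw [proj_of_mem_ne hx h, proj_of_mem_ne (u.map_gr _ x hx) h, map_zero]
  | add x y hx hy => simp only [map_add, hx, hy]

/-- A map that is surjective in degrees `≤ 1` induces a surjection modulo the truncation ideals. -/
lemma Hom.exists_sub_mem_truncationIdeal (u : Hom f P P')
    (hs : ∀ n ≤ 1, ∀ y ∈ P'.gr n, ∃ x ∈ P.gr n, u.toRingHom x = y) (y : P'.carrier) :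
    ∃ x, y - u.toRingHom x ∈ P'.truncationIdeal p := by
  induction y using P'.homogeneous_induction with
  | zero => exact ⟨0, by rw [map_zero, sub_zero]; exact zero_mem _⟩
  | hom n y hy =>
    rcases Nat.lt_or_ge 1 n with hn | hn
    · obtain ⟨n, rfl⟩ : ∃ k, n = k + 2 := ⟨n - 2, by omega⟩
      exact ⟨0, by rw [map_zero, sub_zero]; exact mem_truncationIdeal_of_mem hy⟩
    · obtain ⟨x, -, rfl⟩ := hs n hn y hy
      exact ⟨x, by rw [sub_self]; exact zero_mem _⟩
  | add y y' hy hy' =>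
    obtain ⟨x, hx⟩ := hy
    obtain ⟨x', hx'⟩ := hy'
    refine ⟨x + x', ?_⟩
    rw [map_add, add_sub_add_comm]
    exact add_mem hx hx'

/-- If moreover the kernel in degree `0` is contained in `p² P`, then the induced map modulo the
truncation ideals is injective. -/
lemma Hom.mem_truncationIdeal_of_map (u : Hom f P P') (hp : (p : A) = 0)
    (hP : P.IsWeakEquivalence) (hp' : (p : A') = 0)
    (hs : ∀ n ≤ 1, ∀ y ∈ P'.gr n, ∃ x ∈ P.gr n, u.toRingHom x = y)
    (hk : ∀ x ∈ P.gr 0, u.toRingHom x = 0 → ∃ y ∈ P.gr 0, x = p • p • y) {x : P.carrier}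
    (hx : u.toRingHom x ∈ P'.truncationIdeal p) : x ∈ P.truncationIdeal p := by
  obtain ⟨s, hs'⟩ := exists_sum_proj x
  rw [← hs']
  refine sum_mem fun n _ => ?_
  have h1 : u.toRingHom (GradedRing.proj P.gr n x) ∈ P'.truncationIdeal p := by
    rw [u.map_proj]
    exact (isDGIdeal_truncationIdeal hp').proj_mem n _ hx
  generalize hz : GradedRing.proj P.gr n x = z at h1
  have hzn : z ∈ P.gr n := hz ▸ proj_mem_gr n x
  clear hz hs' hx
  match n with
  | 0 =>
    obtain ⟨t, ht, htz⟩ := exists_of_mem_truncationIdeal_zero (u.map_gr 0 z hzn) h1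
    obtain ⟨t, ht', rfl⟩ := hs 0 (by omega) t ht
    obtain ⟨y, -, hy⟩ := hk (z - p • t) (sub_mem hzn (nsmul_mem ht' p))
      (by rw [map_sub, map_nsmul, htz, sub_self])
    rw [sub_eq_iff_eq_add, ← smul_add] at hy
    rw [hy]
    exact nsmul_mem_truncationIdeal _
  | 1 =>
    obtain ⟨t, ht, w, hw, htz⟩ := exists_of_mem_truncationIdeal_one (u.map_gr 1 z hzn) h1
    obtain ⟨t, ht', rfl⟩ := hs 1 le_rfl t ht
    have hzt : z - p • t ∈ P.gr 1 := sub_mem hzn (nsmul_mem ht' p)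
    -- This is where the square of `p` matters. The boundary is `p • (p • y)`, and `p • y` vanishes
    -- in `A`, so `p • y = d b`; then `z - p • t - p • b` is a cycle of degree 1, hence a boundary.
    obtain ⟨y, hy0, hy⟩ := hk (P.d (z - p • t)) (P.d_succ 0 _ hzt)
      (by rw [u.map_d, map_sub, map_nsmul, htz, add_sub_cancel_left, P'.d_d])
    obtain ⟨b, hb, hby⟩ := hP.injective (p • y) (nsmul_mem hy0 p)
      (by rw [map_nsmul, nsmul_eq_mul, hp, zero_mul])
    obtain ⟨w', hw', hwz⟩ := hP.exact 0 (z - p • t - p • b) (sub_mem hzt (nsmul_mem hb p))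
      (by rw [map_sub, hy, map_nsmul, hby, sub_self])
    rw [sub_sub, ← smul_add, eq_sub_iff_add_eq] at hwz
    rw [← hwz]
    exact add_mem (d_mem_truncationIdeal hw') (nsmul_mem_truncationIdeal _)
  | n + 2 => exact mem_truncationIdeal_of_mem hzn

end TruncationIdealMap

/-! ### Comparison of the cohomology of two algebras with the same truncation -/

section Comparison

variable {K K' : Type} [CommRing K] [CommRing K'] [Algebra K K']
  {A : Type u} [Ring A] [Algebra K A] [Algebra K' A]
  {P : ChainAlgebraOver K A} {P' : ChainAlgebraOver K' A}
  {M : Type v} [AddCommGroup M] [Module A M] [Module Aᵐᵒᵖ M]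
  {T : AddSubgroup P.carrier} {T' : AddSubgroup P'.carrier}

lemma pullback_apply {A' : Type u} [Ring A'] [Algebra K' A'] {f : A →+* A'}
    {P'' : ChainAlgebraOver K' A'} {M' : Type v} [AddCommGroup M'] [Module A' M']
    [Module A'ᵐᵒᵖ M'] (u : Hom f P P'') (φ : BimoduleHom f M' M) (c : P''.Family M') (n : ℕ)
    (r : Fin n → P.carrier) :
    pullback u φ c n r = φ.toAddMonoidHom (c n fun i => u.toRingHom (r i)) := rfl

/-- Cochains that vanish on `T` descend along a map that induces an isomorphism modulo ideals. -/
lemma exists_pullback_eq (hK' : Function.Surjective (Int.cast : ℤ → K'))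
    (u : Hom (RingHom.id A) P P') (hinj : ∀ x, u.toRingHom x ∈ T' → x ∈ T)
    (hsurj : ∀ y, ∃ x, y - u.toRingHom x ∈ T') (hT' : IsDGIdeal P' T') {m : ℕ} {c : P.Family M}
    (hc : c ∈ P.cochains M m) (hv : ∀ n, VanishesOn T (c n)) :
    ∃ c' ∈ P'.cochains M m, (∀ n, VanishesOn T' (c' n)) ∧
      pullback u (BimoduleHom.id M) c' = c := by
  -- A set-theoretic inverse modulo the ideals is enough: `c` depends only on its arguments modulo
  -- `T`, where `σ` is additive and compatible with degrees.
  choose σ hσ using hsurj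
  have ha := cochains_multiadditive hc
  have heq : ∀ n (r r' : Fin n → P.carrier), (∀ i, u.toRingHom (r i) - u.toRingHom (r' i) ∈ T') →
      c n r = c n r' := fun n r r' h =>
    (ha n).eq_of_sub_mem T (hv n) r r' fun i => hinj _ (by rw [map_sub]; exact h i)
  refine ⟨fun n r => c n fun i => σ (r i), mem_cochains hK' (fun n r i x y => ?_)
    (fun n r e hr he => ?_), fun n r i hr => ?_, ?_⟩
  · have key : ∀ x z, u.toRingHom z - u.toRingHom (σ x) ∈ T' →
        c n (fun j => σ (Function.update r i x j)) =
        c n (Function.update (fun j => σ (r j)) i z) := by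
      intro x z hz
      refine heq n _ _ fun j => ?_
      rcases eq_or_ne j i with rfl | h
      · rw [Function.update_self, Function.update_self, ← neg_sub]; exact neg_mem hz
      · rw [Function.update_of_ne h, Function.update_of_ne h, sub_self]; exact zero_mem _
    rw [key x (σ x) (by rw [sub_self]; exact zero_mem _),
      key y (σ y) (by rw [sub_self]; exact zero_mem _), key (x + y) (σ x + σ y), ha n]
    have h := sub_mem (hσ (x + y)) (add_mem (hσ x) (hσ y))
    rw [map_add]
    convert h using 1
    abel
  · have h1 : ∀ i, u.toRingHom (σ (r i)) -
        u.toRingHom (GradedRing.proj P.gr (e i) (σ (r i))) ∈ T' := by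
      intro i
      have h2 := hT'.proj_mem (e i) _ (hσ (r i))
      rw [map_sub, proj_of_mem (hr i), ← u.map_proj] at h2
      have h3 := sub_mem h2 (hσ (r i))
      rwa [sub_sub_sub_cancel_left] at h3
    rw [heq n _ _ h1]
    exact cochains_hasDegree hc n _ e (fun i => proj_mem_gr _ _) he
  · refine hv n _ i (hinj _ ?_)
    have := sub_mem hr (hσ (r i))
    rwa [sub_sub_cancel] at this
  · funext n r
    exact heq n _ _ fun i => by
      rw [← neg_sub]; exact neg_mem (hσ (u.toRingHom (r i)))

/-- The image of `u` meets every class modulo `T'`, and `c` depends only on these classes. -/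
lemma eq_zero_of_pullback_eq_zero (u : Hom (RingHom.id A) P P')
    (hsurj : ∀ y, ∃ x, y - u.toRingHom x ∈ T') {m : ℕ} {c : P'.Family M}
    (hc : c ∈ P'.cochains M m) (hv : ∀ n, VanishesOn T' (c n))
    (h0 : pullback u (BimoduleHom.id M) c = 0) : c = 0 := by
  choose σ hσ using hsurj
  funext n r
  rw [(cochains_multiadditive hc n).eq_of_sub_mem T' (hv n) r (fun i => u.toRingHom (σ (r i)))
    fun i => hσ (r i)]
  exact congrFun (congrFun h0 n) fun i => σ (r i)

variable (M) in
/-- The cocycles that vanish if one of the arguments lies in `T`. -/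
def vanishingCocycles (T : AddSubgroup P.carrier) (m : ℕ) : AddSubgroup (P.Family M) where
  carrier := {c | c ∈ P.cocycles M m ∧ ∀ n, VanishesOn T (c n)}
  zero_mem' := ⟨zero_mem _, fun _ _ _ _ => rfl⟩
  add_mem' h h' := ⟨add_mem h.1 h'.1, fun n => (h.2 n).add (h'.2 n)⟩
  neg_mem' h := ⟨(P.cocycles M m).neg_mem h.1, fun n r i hr => by
    rw [Pi.neg_apply, Pi.neg_apply, h.2 n r i hr, neg_zero]⟩

variable (M) in
/-- The cohomology class of a cocycle that vanishes on `T`. -/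
def vanishingClass (T : AddSubgroup P.carrier) (m : ℕ) :
    vanishingCocycles M T m →+ P.Hochschild M m :=
  (QuotientAddGroup.mk' _).comp (AddSubgroup.inclusion fun _ h => h.1)

lemma vanishingClass_eq_zero_iff {m : ℕ} (c : vanishingCocycles M T m) :
    vanishingClass M T m c = 0 ↔ c.1 ∈ P.coboundaries M m :=
  QuotientAddGroup.eq_zero_iff _

variable [SMulCommClass A Aᵐᵒᵖ M]

/-- If `T` is contractible, then cohomology is represented by cocycles that vanish on `T`. -/
lemma vanishingClass_surjective (hK : Function.Surjective (Int.cast : ℤ → K))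
    (hT : IsDGIdeal P T) {p N : ℕ} (hp : ∀ x : M, p • x = 0) (H : Contraction P T p N) {m : ℕ}
    (hm : m ≤ N) : Function.Surjective (vanishingClass M T m) := by
  intro x
  obtain ⟨⟨c, hc⟩, rfl⟩ := QuotientAddGroup.mk'_surjective _ x
  have hdc : P.differential M c = 0 := hc.2
  cases m with
  | zero => exact ⟨⟨c, hc, vanishesOn_of_mem_cochains_zero hc.1⟩, rfl⟩
  | succ m =>
    obtain ⟨b, hb, hbv⟩ := exists_sub_differential_vanishesOn hK hT hp H hm hc.1
      (by rw [hdc]; exact fun _ _ _ _ => rfl)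
    refine ⟨⟨c - P.differential M b, ⟨(P.cochains M (m + 1)).sub_mem hc.1 (differential_mem hK hb), ?_⟩, hbv⟩, ?_⟩
    · change P.differential M _ = 0
      rw [map_sub, hdc, differential_differential (cochains_multiadditive hb), sub_zero]
    · refine QuotientAddGroup.eq.2 ?_
      refine ⟨b, hb, ?_⟩
      change _ = -(c - P.differential M b) + c
      abel

/-- The comparison of cohomology with the cocycles on `P'` that vanish on `T'`. -/
lemma exists_vanishingCocycle (hK' : Function.Surjective (Int.cast : ℤ → K'))
    (u : Hom (RingHom.id A) P P') (hinj : ∀ x, u.toRingHom x ∈ T' → x ∈ T)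
    (hsurj : ∀ y, ∃ x, y - u.toRingHom x ∈ T') (hT' : IsDGIdeal P' T') {m : ℕ}
    (c : vanishingCocycles M T m) :
    ∃ c' : vanishingCocycles M T' m, pullback u (BimoduleHom.id M) c'.1 = c.1 := by
  obtain ⟨c, hc, hv⟩ := c
  obtain ⟨c', hc', hv', hcc'⟩ := exists_pullback_eq hK' u hinj hsurj hT' hc.1 hv
  refine ⟨⟨c', ⟨hc', ?_⟩, hv'⟩, hcc'⟩
  -- The coboundary of `c'` again vanishes on `T'`, so it can be tested after pullback.
  refine eq_zero_of_pullback_eq_zero u hsurj (differential_mem hK' hc')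
    (vanishesOn_differential hT' hv') ?_
  rw [← pullback_differential, hcc']
  exact hc.2

/-- If the pullback of `c` is the coboundary of `e`, that coboundary vanishes on `T`; so `e` can be
made to vanish on `T` without changing its coboundary, and then descends to `P'`. As `e` has degree
one less than `c`, the bound is `N + 1` instead of `N`. -/
lemma mem_coboundaries_of_pullback (hK : Function.Surjective (Int.cast : ℤ → K))
    (hK' : Function.Surjective (Int.cast : ℤ → K'))
    (u : Hom (RingHom.id A) P P') (hmap : ∀ x ∈ T, u.toRingHom x ∈ T')
    (hinj : ∀ x, u.toRingHom x ∈ T' → x ∈ T)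
    (hsurj : ∀ y, ∃ x, y - u.toRingHom x ∈ T') (hT : IsDGIdeal P T) (hT' : IsDGIdeal P' T')
    {p N : ℕ} (hp : ∀ x : M, p • x = 0) (H : Contraction P T p N) {m : ℕ} (hm : m ≤ N + 1)
    (c : vanishingCocycles M T' m)
    (hc : pullback u (BimoduleHom.id M) c.1 ∈ P.coboundaries M m) :
    c.1 ∈ P'.coboundaries M m := by
  obtain ⟨c, hcc, hv⟩ := c
  cases m with
  | zero =>
    have : c = 0 := eq_zero_of_pullback_eq_zero u hsurj hcc.1 hv hc
    exact this
  | succ m =>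
    obtain ⟨e, he, hec⟩ := hc
    have hpv : ∀ n, VanishesOn T (P.differential M e n) := by
      intro n r i hr
      rw [hec]
      exact hv n (fun i => u.toRingHom (r i)) i (hmap _ hr)
    obtain ⟨e', he', hv', hee'⟩ : ∃ e' ∈ P.cochains M m, (∀ n, VanishesOn T (e' n)) ∧
        P.differential M e' = P.differential M e := by
      cases m with
      | zero => exact ⟨e, he, vanishesOn_of_mem_cochains_zero he, rfl⟩
      | succ m =>
        obtain ⟨b, hb, hbv⟩ := exists_sub_differential_vanishesOn hK hT hp H (by omega) he hpv
        refine ⟨_, sub_mem he (differential_mem hK hb), hbv, ?_⟩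
        rw [map_sub, differential_differential (cochains_multiadditive hb), sub_zero]
    obtain ⟨b, hb, hbv, hbe⟩ := exists_pullback_eq hK' u hinj hsurj hT' he' hv'
    refine ⟨b, hb, ?_⟩
    refine sub_eq_zero.1 (eq_zero_of_pullback_eq_zero (T' := T') u hsurj
      (sub_mem (differential_mem hK' hb) hcc.1)
      (fun n => (vanishesOn_differential hT' hbv n).sub (hv n)) ?_)
    rw [map_sub, ← pullback_differential, hbe, hee', hec, sub_self]

end Comparison

end ChainAlgebraOver

namespace FreeGraded

lemma eq_zero_of_nsmul_eq_zero {X : Type u} {n : ℕ} (hn : n ≠ 0) (x : FreeAlgebra ℤ X)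
    (hx : n • x = 0) : x = 0 := by
  let b := FreeAlgebra.basisFreeMonoid ℤ X
  refine b.ext_elem fun w => ?_
  have h1 : b.repr (n • x) w = 0 := by rw [hx, map_zero]; rfl
  rw [map_nsmul, Finsupp.smul_apply, nsmul_eq_mul] at h1
  rw [(mul_eq_zero.1 h1).resolve_left (by exact_mod_cast hn), map_zero]
  rfl

end FreeGraded

/-! ### Strict functoriality of the replacement, and reduction in degrees 0 and 1 -/

namespace Cells

open FreeGraded

section Composition

variable {K K' K'' : Type} [CommRing K] [CommRing K'] [CommRing K''] [Algebra K K']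
  [Algebra K' K''] [Algebra K K''] [IsScalarTower K K' K'']
  {A A' A'' : Type u} [Ring A] [Algebra K A] [Ring A'] [Algebra K' A'] [Ring A''] [Algebra K'' A'']
  {f : A →+* A'} {f' : A' →+* A''} {g : A →+* A''}
  (hf : ∀ k, f (algebraMap K A k) = algebraMap K' A' (algebraMap K K' k))
  (hf' : ∀ k, f' (algebraMap K' A' k) = algebraMap K'' A'' (algebraMap K' K'' k))
  (hg : ∀ k, g (algebraMap K A k) = algebraMap K'' A'' (algebraMap K K'' k))
  (hfg : ∀ a, f' (f a) = g a)
include hfg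

/-- The attached generators are the cycles themselves and no choices are made, so functoriality
holds on the nose. Naturality of the splitting then needs no homotopies. -/
lemma stageMap_stageMap (n : ℕ) (x : (stage K A n).gen) :
    (stageMap f' hf' n).map ((stageMap f hf n).map x) = (stageMap g hg n).map x := by
  induction n with
  | zero => exact hfg x
  | succ n ih =>
    rcases x with x | z
    · exact congrArg Sum.inl (ih x)
    · refine congrArg Sum.inr (Subtype.ext ?_)
      exact (push_push _ _ _).trans (congrArg (fun m => push K K'' m z.1) (funext ih))

lemma limitMapGen_limitMapGen (x : (limit K A).gen) :
    limitMapGen f' hf' (limitMapGen f hf x) = limitMapGen g hg x := by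
  rcases x with a | ⟨n, z⟩
  · exact congrArg Sum.inl (hfg a)
  · refine congrArg Sum.inr (Sigma.ext rfl (heq_of_eq (Subtype.ext ?_)))
    exact (push_push _ _ _).trans (congrArg (fun m => push K K'' m z.1)
      (funext (stageMap_stageMap hf hf' hg hfg n)))

lemma quasiFreeReplacementMap_comp (x : (quasiFreeReplacement K A).carrier) :
    (quasiFreeReplacementMap f' hf').toRingHom ((quasiFreeReplacementMap f hf).toRingHom x) =
      (quasiFreeReplacementMap g hg).toRingHom x :=
  (push_push _ _ _).trans (congrArg (fun m => push K K'' m x)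
    (funext (limitMapGen_limitMapGen hf hf' hg hfg)))

end Composition

section Reduction

variable {n : ℕ} {A : Type u} [Ring A] [Algebra (ZMod n) A]
  (hf : ∀ k : ℤ, RingHom.id A (algebraMap ℤ A k) =
    algebraMap (ZMod n) A (algebraMap ℤ (ZMod n) k))

/-- The reduction modulo `n` is surjective in degrees `≤ 1`. -/
lemma exists_quasiFreeReplacementMap_eq (q : ℕ) (hq : q ≤ 1)
    (y : (quasiFreeReplacement (ZMod n) A).carrier)
    (hy : y ∈ (quasiFreeReplacement (ZMod n) A).gr q) :
    ∃ x ∈ (quasiFreeReplacement ℤ A).gr q,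
      (quasiFreeReplacementMap (RingHom.id A) hf).toRingHom x = y := by
  have hK : Function.Surjective (algebraMap ℤ (ZMod n)) := ZMod.intCast_surjective
  refine exists_push_eq hK (limitMap (RingHom.id A) hf).deg_map (fun g hg => ?_) hy
  rcases g with a | ⟨k, z⟩
  · exact ⟨Sum.inl a, rfl⟩
  · change k + 1 ≤ q at hg
    obtain rfl : k = 0 := by omega
    obtain ⟨x, hx, hxz⟩ := exists_push_eq hK (stageMap (RingHom.id A) hf 0).deg_map
      (fun g _ => ⟨g, rfl⟩) z.2.1
    -- Stage 0 has no differential, so every lift of `z` is a cycle. For generators of higher degree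
    -- a lift of a cycle need not be one, hence the restriction to `q ≤ 1`.
    have hD : (stage ℤ A 0).D x = 0 :=
      boundary_zero (fun _ _ => rfl) (fun g n (h : 0 = n + 1) => by omega) hx
    have hE : (stage ℤ A 0).E x = 0 := by
      have h := (stageMap (RingHom.id A) hf 0).E_push hf x
      rw [hxz, z.2.2.2] at h
      exact h.symm
    exact ⟨Sum.inr ⟨0, x, hx, hD, hE⟩,
      congrArg Sum.inr (Sigma.ext rfl (heq_of_eq (Subtype.ext hxz)))⟩

/-- The kernel of the reduction modulo `n` in degree `0`. -/
lemma exists_eq_nsmul_of_quasiFreeReplacementMap_eq_zero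
    (x : (quasiFreeReplacement ℤ A).carrier) (hx : x ∈ (quasiFreeReplacement ℤ A).gr 0)
    (h : (quasiFreeReplacementMap (RingHom.id A) hf).toRingHom x = 0) :
    ∃ y ∈ (quasiFreeReplacement ℤ A).gr 0, x = n • y := by
  obtain ⟨y, -, hyx⟩ := exists_push ℤ A 0 hx
  have h1 : push (ZMod n) (ZMod n) (toLimit (ZMod n) A 0)
      (push ℤ (ZMod n) (id : A → A) y) = 0 := by
    refine Eq.trans ?_ h
    rw [← hyx]
    exact (push_push (id : A → A) (toLimit (ZMod n) A 0) y).trans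
      (push_push (toLimit ℤ A 0) (limitMapGen (RingHom.id A) hf) y).symm
  have h2 : push ℤ (ZMod n) (id : A → A) y = 0 :=
    push_injective _ (toLimit_injective (ZMod n) A 0) (h1.trans (map_zero _).symm)
  obtain ⟨z, hz⟩ := exists_eq_nsmul_of_push_eq_zero y h2
  let w : (quasiFreeReplacement ℤ A).carrier := push ℤ ℤ (toLimitHom ℤ A 0).map z
  have hw : x = n • w := hyx.symm.trans ((congrArg _ hz).trans (map_nsmul _ _ _))
  -- The quotient `w` need not be homogeneous; its component of degree 0 serves as well.
  refine ⟨_, ChainAlgebraOver.proj_mem_gr 0 w, ?_⟩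
  rw [← map_nsmul, ← hw, ChainAlgebraOver.proj_of_mem hx]

end Reduction

end Cells

/-! ### The splitting and its naturality -/

namespace Shukla

open ChainAlgebraOver Cells

lemma natCast_eq_zero (p : ℕ) {A : Type u} [Ring A] [Algebra (ZMod p) A] : (p : A) = 0 := by
  rw [← map_natCast (algebraMap (ZMod p) A), ZMod.natCast_self, map_zero]

lemma nsmul_eq_zero (p : ℕ) (A : Type u) [Ring A] [Algebra (ZMod p) A] {M : Type v}
    [AddCommGroup M] [Module A M] (x : M) : p • x = 0 := by
  rw [← Nat.cast_smul_eq_nsmul A, natCast_eq_zero, zero_smul]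

section

variable (p : ℕ) [Fact p.Prime] (A : Type u) [Ring A] [Algebra (ZMod p) A]
  (M : Type v) [AddCommGroup M] [Module A M] [Module Aᵐᵒᵖ M]

/-- The map of quasi-free chain algebras that induces the base change homomorphism. -/
def reduction : ChainAlgebraOver.Hom (RingHom.id A) (quasiFreeReplacement ℤ A)
    (quasiFreeReplacement (ZMod (p ^ 2)) A) :=
  quasiFreeReplacementMap (RingHom.id A) fun k => by simp

/-- The cocycles over `ℤ/p²` that vanish on the truncation ideal. -/
abbrev TruncatedCocycles (n : ℕ) : Type (max u v) :=
  vanishingCocycles M ((quasiFreeReplacement (ZMod (p ^ 2)) A).truncationIdeal p) n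

/-- The class over `ℤ/p²` of a truncated cocycle. -/
def truncatedClass (n : ℕ) : TruncatedCocycles p A M n →+ Shukla (ZMod (p ^ 2)) A M n :=
  vanishingClass M _ n

lemma intCast_int_surjective : Function.Surjective (Int.cast : ℤ → ℤ) := fun k => ⟨k, rfl⟩

instance (K : Type) [CommRing K] (A : Type u) [Ring A] [Algebra K A] :
    Module.Projective K (quasiFreeReplacement K A).carrier :=
  inferInstanceAs (Module.Projective K (FreeAlgebra K (limit K A).gen))

lemma reduction_surjective (y : (quasiFreeReplacement (ZMod (p ^ 2)) A).carrier) :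
    ∃ x, y - (reduction p A).toRingHom x ∈
      (quasiFreeReplacement (ZMod (p ^ 2)) A).truncationIdeal p :=
  (reduction p A).exists_sub_mem_truncationIdeal
    (fun q hq y hy => exists_quasiFreeReplacementMap_eq _ q hq y hy) y

lemma reduction_injective (x : (quasiFreeReplacement ℤ A).carrier)
    (hx : (reduction p A).toRingHom x ∈
      (quasiFreeReplacement (ZMod (p ^ 2)) A).truncationIdeal p) :
    x ∈ (quasiFreeReplacement ℤ A).truncationIdeal p := by
  refine (reduction p A).mem_truncationIdeal_of_map (natCast_eq_zero p)
    (quasiFreeReplacement_isWeakEquivalence ℤ A) (natCast_eq_zero p)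
    (fun q hq y hy => exists_quasiFreeReplacementMap_eq _ q hq y hy) (fun x hx h => ?_) hx
  obtain ⟨y, hy, hxy⟩ := exists_eq_nsmul_of_quasiFreeReplacementMap_eq_zero _ x hx h
  exact ⟨y, hy, by rw [hxy, smul_smul, pow_two]⟩

lemma exists_contraction_int (N : ℕ) : Nonempty (Contraction (quasiFreeReplacement ℤ A)
    ((quasiFreeReplacement ℤ A).truncationIdeal p) p N) := by
  refine exists_contraction_of_torsionFree intCast_int_surjective (natCast_eq_zero p)
    (quasiFreeReplacement_isWeakEquivalence ℤ A) (fun x hx => ?_) N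
  exact FreeGraded.eq_zero_of_nsmul_eq_zero (Fact.out : p.Prime).ne_zero x hx

variable [SMulCommClass A Aᵐᵒᵖ M] (n : ℕ)

/-- Every class over ℤ is represented by a cocycle that vanishes on `T`, which descends to `P'`
because the truncations agree. -/
lemma baseChange_truncatedClass_surjective :
    Function.Surjective ((baseChange p A M n).comp (truncatedClass p A M n)) := by
  intro x
  obtain ⟨H⟩ := exists_contraction_int p A n
  obtain ⟨c, rfl⟩ := vanishingClass_surjective intCast_int_surjective
    (isDGIdeal_truncationIdeal (natCast_eq_zero p)) (nsmul_eq_zero p A) H le_rfl x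
  obtain ⟨c', hc'⟩ := exists_vanishingCocycle ZMod.intCast_surjective (reduction p A)
    (reduction_injective p A) (reduction_surjective p A)
    (isDGIdeal_truncationIdeal (natCast_eq_zero p)) c
  exact ⟨c', congrArg (QuotientAddGroup.mk' _) (Subtype.ext hc')⟩

/-- A truncated cocycle that becomes a coboundary over ℤ is already one over ℤ/p². Hence
`truncatedClass` factors through the composite, which defines the splitting. -/
lemma ker_baseChange_truncatedClass :
    ((baseChange p A M n).comp (truncatedClass p A M n)).ker ≤ (truncatedClass p A M n).ker := by
  intro c hc
  obtain ⟨H⟩ := exists_contraction_int p A n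
  refine (vanishingClass_eq_zero_iff c).2 ?_
  refine mem_coboundaries_of_pullback intCast_int_surjective ZMod.intCast_surjective
    (reduction p A) (fun x hx => (reduction p A).map_truncationIdeal hx)
    (reduction_injective p A) (reduction_surjective p A)
    (isDGIdeal_truncationIdeal (natCast_eq_zero p)) (isDGIdeal_truncationIdeal (natCast_eq_zero p))
    (nsmul_eq_zero p A) H (Nat.le_succ n) c ?_
  have h := AddMonoidHom.mem_ker.1 hc
  exact (QuotientAddGroup.eq_zero_iff (N := AddSubgroup.addSubgroupOf
    ((quasiFreeReplacement ℤ A).coboundaries M n) ((quasiFreeReplacement ℤ A).cocycles M n)) _).1 h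

/-- The arguments of a cochain of degree at most 2 have degree at most 1, where `T'` is contractible
modulo `p`. -/
lemma truncatedClass_surjective (hn : n ≤ 2) :
    Function.Surjective (truncatedClass p A M n) := by
  obtain ⟨H⟩ := exists_contraction_two (P := quasiFreeReplacement (ZMod (p ^ 2)) A) (p := p)
    ZMod.intCast_surjective (natCast_eq_zero p)
  exact vanishingClass_surjective ZMod.intCast_surjective
    (isDGIdeal_truncationIdeal (natCast_eq_zero p)) (nsmul_eq_zero p A) H hn

/-- The natural splitting of the base change homomorphism. -/
def splitting : Shukla ℤ A M n →+ Shukla (ZMod (p ^ 2)) A M n :=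
  AddMonoidHom.liftOfSurjective _ (baseChange_truncatedClass_surjective p A M n)
    ⟨truncatedClass p A M n, ker_baseChange_truncatedClass p A M n⟩

/-- This formula determines `splitting`; the section property, injectivity for n ≤ 2 and naturality
are all read off from it. -/
lemma splitting_baseChange (c : TruncatedCocycles p A M n) :
    splitting p A M n (baseChange p A M n (truncatedClass p A M n c)) =
      truncatedClass p A M n c :=
  AddMonoidHom.liftOfRightInverse_comp_apply _ _
    (Function.rightInverse_surjInv (baseChange_truncatedClass_surjective p A M n))
    ⟨truncatedClass p A M n, ker_baseChange_truncatedClass p A M n⟩ c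

end

section Naturality

variable {p : ℕ} [Fact p.Prime] {A A' : Type u} [Ring A] [Algebra (ZMod p) A]
  [Ring A'] [Algebra (ZMod p) A'] {M M' : Type v} [AddCommGroup M] [Module A M] [Module Aᵐᵒᵖ M]
  [AddCommGroup M'] [Module A' M'] [Module A'ᵐᵒᵖ M'] {f : A →+* A'}

lemma algebraMap_zmodSq (f : A →+* A') (k : ZMod (p ^ 2)) :
    f (algebraMap (ZMod (p ^ 2)) A k) =
      algebraMap (ZMod (p ^ 2)) A' (algebraMap (ZMod (p ^ 2)) (ZMod (p ^ 2)) k) :=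
  DFunLike.congr_fun (Subsingleton.elim (f.comp (algebraMap (ZMod (p ^ 2)) A))
    (algebraMap (ZMod (p ^ 2)) A')) k

/-- Functoriality of truncated cocycles. -/
def TruncatedCocycles.map (φ : BimoduleHom f M' M) {n : ℕ} (c : TruncatedCocycles p A' M' n) :
    TruncatedCocycles p A M n :=
  ⟨pullback (quasiFreeReplacementMap f (algebraMap_zmodSq f)) φ c.1,
    ⟨pullback_mem _ φ (algebraMap_zmodSq f) c.2.1.1, by
      change (quasiFreeReplacement (ZMod (p ^ 2)) A).differential M _ = 0
      rw [pullback_differential,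
        show (quasiFreeReplacement (ZMod (p ^ 2)) A').differential M' c.1 = 0 from c.2.1.2,
        map_zero]⟩,
    fun n r i hr => by
      rw [pullback_apply, c.2.2 n _ i (Hom.map_truncationIdeal _ hr), map_zero]⟩

lemma mapZModSq_truncatedClass (φ : BimoduleHom f M' M) {n : ℕ}
    (c : TruncatedCocycles p A' M' n) :
    mapZModSq p φ n (truncatedClass p A' M' n c) = truncatedClass p A M n (c.map φ) := rfl

/-- By strict functoriality both sides are pullbacks along the same map from the replacement of `A`
over ℤ to that of `A'` over ℤ/p². -/
lemma mapInt_baseChange_truncatedClass (φ : BimoduleHom f M' M) {n : ℕ}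
    (c : TruncatedCocycles p A' M' n) :
    mapInt φ n (baseChange p A' M' n (truncatedClass p A' M' n c)) =
      baseChange p A M n (truncatedClass p A M n (c.map φ)) := by
  have hf : ∀ k : ℤ, f (algebraMap ℤ A k) = algebraMap ℤ A' (algebraMap ℤ ℤ k) := fun k => by simp
  have hg : ∀ k : ℤ, f (algebraMap ℤ A k) =
      algebraMap (ZMod (p ^ 2)) A' (algebraMap ℤ (ZMod (p ^ 2)) k) := fun k => by simp
  refine congrArg (QuotientAddGroup.mk' _) (Subtype.ext ?_)
  change pullback (quasiFreeReplacementMap f hf) φ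
      (pullback (reduction p A') (BimoduleHom.id M') c.1) =
    pullback (reduction p A) (BimoduleHom.id M)
      (pullback (quasiFreeReplacementMap f (algebraMap_zmodSq f)) φ c.1)
  funext k r
  refine congrArg (fun s => φ.toAddMonoidHom (c.1 k s)) (funext fun i => ?_)
  exact (quasiFreeReplacementMap_comp _ _ hg (fun _ => rfl) (r i)).trans
    (quasiFreeReplacementMap_comp _ _ hg (fun _ => rfl) (r i)).symm

end Naturality

end Shukla

theorem mainTheorem11 (p : ℕ) [Fact p.Prime] :
    (∀ (n : ℕ) (A : Type u) [Ring A] [Algebra (ZMod p) A]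
      (M : Type v) [AddCommGroup M] [Module A M] [Module Aᵐᵒᵖ M] [SMulCommClass A Aᵐᵒᵖ M],
      Function.Surjective (Shukla.baseChange p A M n) ∧
      (n ≤ 2 → Function.Bijective (Shukla.baseChange p A M n))) ∧
    ∀ n : ℕ, ∃ d : ∀ (A : Type u) [Ring A] [Algebra (ZMod p) A]
      (M : Type v) [AddCommGroup M] [Module A M] [Module Aᵐᵒᵖ M] [SMulCommClass A Aᵐᵒᵖ M],
      Shukla ℤ A M n →+ Shukla (ZMod (p ^ 2)) A M n,
      (∀ (A : Type u) [Ring A] [Algebra (ZMod p) A]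
        (M : Type v) [AddCommGroup M] [Module A M] [Module Aᵐᵒᵖ M] [SMulCommClass A Aᵐᵒᵖ M]
        (x : Shukla ℤ A M n), Shukla.baseChange p A M n (d A M x) = x) ∧
      (∀ (A A' : Type u) [Ring A] [Algebra (ZMod p) A] [Ring A'] [Algebra (ZMod p) A']
        (M M' : Type v) [AddCommGroup M] [Module A M] [Module Aᵐᵒᵖ M] [SMulCommClass A Aᵐᵒᵖ M]
        [AddCommGroup M'] [Module A' M'] [Module A'ᵐᵒᵖ M'] [SMulCommClass A' A'ᵐᵒᵖ M']
        (f : A →+* A') (φ : BimoduleHom f M' M) (x : Shukla ℤ A' M' n),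
        d A M (Shukla.mapInt φ n x) = Shukla.mapZModSq p φ n (d A' M' x)) := by
  have hsplit : ∀ (n : ℕ) (A : Type u) [Ring A] [Algebra (ZMod p) A]
      (M : Type v) [AddCommGroup M] [Module A M] [Module Aᵐᵒᵖ M] [SMulCommClass A Aᵐᵒᵖ M]
      (x : Shukla ℤ A M n), Shukla.baseChange p A M n (Shukla.splitting p A M n x) = x := by
    intro n A _ _ M _ _ _ _ x
    obtain ⟨c, rfl⟩ := Shukla.baseChange_truncatedClass_surjective p A M n x
    exact congrArg _ (Shukla.splitting_baseChange p A M n c)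
  refine ⟨fun n A _ _ M _ _ _ _ => ?_, fun n => ⟨fun A _ _ M _ _ _ _ => Shukla.splitting p A M n,
    fun A _ _ M _ _ _ _ x => hsplit n A M x, fun A A' _ _ _ _ M M' _ _ _ _ _ _ _ _ f φ x => ?_⟩⟩
  · have hsurj : Function.Surjective (Shukla.baseChange p A M n) :=
      fun x => ⟨_, hsplit n A M x⟩
    refine ⟨hsurj, fun hn => ⟨?_, hsurj⟩⟩
    refine Function.LeftInverse.injective (g := Shukla.splitting p A M n) fun x => ?_
    -- The splitting inverts `b^n` on truncated classes, and for n ≤ 2 there are no others.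
    obtain ⟨c, rfl⟩ := Shukla.truncatedClass_surjective p A M n hn x
    exact Shukla.splitting_baseChange p A M n c
  · obtain ⟨c, rfl⟩ := Shukla.baseChange_truncatedClass_surjective p A' M' n x
    rw [AddMonoidHom.comp_apply, Shukla.mapInt_baseChange_truncatedClass,
      Shukla.splitting_baseChange, Shukla.splitting_baseChange, Shukla.mapZModSq_truncatedClass]

end
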